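/- **Setting.** Let $\mathbb N=\{1,2,\dots\}$; for finite nonempty $E,F\subset\mathbb N$ write $E<F$ if $\max E<\min F$. The Schreier families $\mathcal S_\alpha$ ($\alpha<\omega_1$) of finite subsets of $\mathbb N$ are defined by $\mathcal S_0=\{F:|F|\le 1\}$; $$\mathcal S_{\beta+1}=\Big\{\bigcup_{i=1}^d S_i:\ d\in\mathbb N,\ S_1<\dots<S_d \text{ nonempty sets in }\mathcal S_\beta,\ d\le\min S_1\Big\}\cup\{\emptyset\};$$ and, for a nonzero limit ordinal $\lambda$, $$\mathcal S_\lambda=\{F\neq\emptyset:\ F\in\mathcal S_{\beta_n+1}\text{ and } n\le\min F\text{ for some }n\in\mathbb N\}\cup\{\emptyset\},$$ where $(\beta_n+1)_{n\ge 1}$ is a fixed strictly increasing sequence of successor ordinals (depending on $\lambda$) converging to $\lambda$ with $\mathcal S_{\beta_n}\subset\mathcal S_{\beta_{n+1}}$ for all $n$. The theorem holds for every such choice of sequences. Let $0<\theta\le\frac12$ and let $\mathcal F$ be one of these families. On the real space $c_{00}$ of finitely supported sequences, with unit vectors $(e_i)_{i\ge1}$, let $\|x\|_0=\max_i|x_i|$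 and $$\|x\|_{n+1}=\max\Big\{\|x\|_n,\ \sup\theta\sum_{i=1}^d\|E_ix\|_n\Big\},$$ the supremum being over all $d$ and all finite nonempty sets $E_1<\dots<E_d$ with $\{\min E_1,\dots,\min E_d\}\in\mathcal F$, where $Ex$ is the restriction of $x$ to the coordinates in $E$. Then $\|x\|=\sup_n\|x\|_n$ is a norm, $T[\theta,\mathcal F]$ denotes the completion of $c_{00}$ under it, and every $x\in T[\theta,\mathcal F]$ has a unique (unconditionally convergent) expansion $x=\sum_{i=1}^\infty a_ie_i$ with real $a_i$. **Theorem.** Let $\theta^{-1}\ge2$ be an integer, let $1\le\alpha<\omega_1$, let $\mathbb S$ be the unit sphere of $T[\theta,\mathcal S_\alpha]$, and let $U:\mathbb S\to\mathbb S$ be a surjective (not necessarily linear) isometry. 1. If $\alpha=1$, there are signs $\varepsilon_i\in\{-1,1\}$ ($i\in\mathbb N$) and a permutation $\pi$ of $\{1,\dots,\theta^{-1}\}$ such that $$U\Big(\sum_{i=1}^\infty a_ie_i\Big)=\sum_{i=1}^{\theta^{-1}}\varepsilon_ia_ie_{\pi(i)}+\sum_{i=\theta^{-1}+1}^\infty\varepsilon_ia_ie_i\qquad\text{for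 every }\sum_{i=1}^\infty a_ie_i\in\mathbb S.$$ 2. If $1<\alpha<\omega_1$, there are signs $\varepsilon_i\in\{-1,1\}$ ($i\in\mathbb N$) such that $$U\Big(\sum_{i=1}^\infty a_ie_i\Big)=\sum_{i=1}^\infty\varepsilon_ia_ie_i\qquad\text{for every }\sum_{i=1}^\infty a_ie_i\in\mathbb S.$$ Consequently, in both cases, $U$ is the restriction to $\mathbb S$ of a surjective linear isometry of $T[\theta,\mathcal S_\alpha]$ onto itself (a positive answer to Tingley's problem for surjective isometries of $\mathbb S$ onto itself). -/

import Mathlib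

open scoped Ordinal

noncomputable section

namespace Tsirelson

/-- `E < F` for finite sets of positive integers: every element of `E` is smaller than every
element of `F`. -/
def Before (E F : Finset ℕ+) : Prop := ∀ a ∈ E, ∀ b ∈ F, a < b

/-- `E 0 < E 1 < ⋯ < E (d - 1)`, all of them nonempty. -/
structure Consecutive {d : ℕ} (E : Fin d → Finset ℕ+) : Prop where
  nonempty : ∀ i, (E i).Nonempty
  before : ∀ i j, i < j → Before (E i) (E j)

/-- The Schreier families. For a limit ordinal `l`, the prescribed sequence of successor ordinals
converging to `l` is `n ↦ β l n + 1`, `n = 1, 2, …`; the conditions on `β` are in `IsLadder`. -/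
def schreier (β : Ordinal.{0} → ℕ+ → Ordinal.{0}) (α : Ordinal.{0}) : Set (Finset ℕ+) :=
  Ordinal.limitRecOn α
    {G | G.card ≤ 1}
    (fun _ S => {G | ∃ (d : ℕ) (B : Fin d → Finset ℕ+), Consecutive B ∧ (∀ i, B i ∈ S) ∧
      (∀ k : ℕ+, k ∈ G → d ≤ (k : ℕ)) ∧ G = Finset.univ.biUnion B} ∪ {∅})
    (fun l _ S => {G | ∃ (n : ℕ+) (h : β l n + 1 < l), G ∈ S (β l n + 1) h ∧ ∀ k : ℕ+, k ∈ G → n ≤ k} ∪ {∅})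

theorem schreier_zero (β : Ordinal.{0} → ℕ+ → Ordinal.{0}) :
    schreier β 0 = {G | G.card ≤ 1} :=
  Ordinal.limitRecOn_zero ..

theorem schreier_add_one (β : Ordinal.{0} → ℕ+ → Ordinal.{0}) (α : Ordinal.{0}) :
    schreier β (α + 1) = {G | ∃ (d : ℕ) (B : Fin d → Finset ℕ+), Consecutive B ∧
      (∀ i, B i ∈ schreier β α) ∧ (∀ k : ℕ+, k ∈ G → d ≤ (k : ℕ)) ∧ G = Finset.univ.biUnion B} ∪ {∅} :=
  Ordinal.limitRecOn_add_one ..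

theorem schreier_limit (β : Ordinal.{0} → ℕ+ → Ordinal.{0}) (l : Ordinal.{0})
    (hl : Order.IsSuccLimit l) :
    schreier β l = {G | ∃ (n : ℕ+) (_ : β l n + 1 < l), G ∈ schreier β (β l n + 1) ∧
      ∀ k : ℕ+, k ∈ G → n ≤ k} ∪ {∅} :=
  Ordinal.limitRecOn_limit _ _ _ _ hl

/-- The admissible choices of sequences at countable limit ordinals: for each nonzero limit
ordinal `l < ω₁` the successor ordinals `β l n + 1` lie below `l`, strictly increase, and converge
to `l`, and the Schreier families of orders `β l n` increase with `n`. -/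
structure IsLadder (β : Ordinal.{0} → ℕ+ → Ordinal.{0}) : Prop where
  lt : ∀ l < ω₁, Order.IsSuccLimit l → ∀ n, β l n + 1 < l
  strictMono : ∀ l < ω₁, Order.IsSuccLimit l → StrictMono (β l)
  cofinal : ∀ l < ω₁, Order.IsSuccLimit l → ∀ γ < l, ∃ n, γ < β l n + 1
  subset : ∀ l < ω₁, Order.IsSuccLimit l → ∀ n, schreier β (β l n) ⊆ schreier β (β l (n + 1))

/-- The projection `E x` of a finitely supported vector `x` onto the coordinates in `E`. -/
def proj (E : Finset ℕ+) (x : ℕ+ →₀ ℝ) : ℕ+ →₀ ℝ := x.filter (fun k => k ∈ E)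

/-- `E 0 < ⋯ < E (d - 1)` and the set of minima of the `E i` belongs to `F`. -/
def Admissible (F : Set (Finset ℕ+)) {d : ℕ} (E : Fin d → Finset ℕ+) : Prop :=
  ∃ h : Consecutive E, Finset.univ.image (fun i => (E i).min' (h.nonempty i)) ∈ F

/-- The values `θ * ∑ i, p (E i x)` over all `F`-admissible `E`. -/
def values (θ : ℝ) (F : Set (Finset ℕ+)) (p : (ℕ+ →₀ ℝ) → ℝ) (x : ℕ+ →₀ ℝ) : Set ℝ :=
  {r | ∃ (d : ℕ) (E : Fin d → Finset ℕ+), Admissible F E ∧ r = θ * ∑ i, p (proj (E i) x)}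

/-- The `n`-th approximating norm on `c₀₀`. -/
def normSeq (θ : ℝ) (F : Set (Finset ℕ+)) : ℕ → (ℕ+ →₀ ℝ) → ℝ
  | 0, x => ⨆ k, |x k|
  | n + 1, x => max (normSeq θ F n x) (sSup (values θ F (normSeq θ F n) x))

/-- The norm of `T[θ, F]` on `c₀₀`. -/
def tsirelsonNorm (θ : ℝ) (F : Set (Finset ℕ+)) (x : ℕ+ →₀ ℝ) : ℝ := ⨆ n, normSeq θ F n x

/-! Verification that `tsirelsonNorm θ F` is a norm if `0 < θ ≤ 1 / 2`. -/

/-- The `ℓ₁`-norm on `c₀₀`. -/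
def l1 (x : ℕ+ →₀ ℝ) : ℝ := ∑ k ∈ x.support, |x k|

theorem l1_nonneg (x : ℕ+ →₀ ℝ) : 0 ≤ l1 x := Finset.sum_nonneg fun _ _ => abs_nonneg _

theorem proj_add (E : Finset ℕ+) (x y : ℕ+ →₀ ℝ) : proj E (x + y) = proj E x + proj E y :=
  Finsupp.filter_add

theorem proj_smul (E : Finset ℕ+) (c : ℝ) (x : ℕ+ →₀ ℝ) : proj E (c • x) = c • proj E x :=
  Finsupp.filter_smul

theorem abs_le_l1 (x : ℕ+ →₀ ℝ) (k : ℕ+) : |x k| ≤ l1 x := by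
  by_cases hk : k ∈ x.support
  · exact Finset.single_le_sum (f := fun k => |x k|) (fun _ _ => abs_nonneg _) hk
  · rw [Finsupp.notMem_support_iff] at hk
    simpa [hk] using l1_nonneg x

theorem l1_proj (E : Finset ℕ+) (x : ℕ+ →₀ ℝ) :
    l1 (proj E x) = ∑ k ∈ x.support, if k ∈ E then |x k| else 0 := by
  unfold l1 proj
  rw [Finsupp.support_filter, Finset.sum_filter]
  refine Finset.sum_congr rfl fun k _ => ?_
  split_ifs with h
  · rw [Finsupp.filter_apply_pos _ _ h]
  · rfl

theorem sum_l1_proj_le {d : ℕ} {E : Fin d → Finset ℕ+} (hE : Consecutive E) (x : ℕ+ →₀ ℝ) :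
    ∑ i, l1 (proj (E i) x) ≤ l1 x := by
  simp_rw [l1_proj]
  rw [Finset.sum_comm]
  refine Finset.sum_le_sum fun k _ => ?_
  by_cases h : ∃ i, k ∈ E i
  · obtain ⟨i, hi⟩ := h
    rw [Finset.sum_eq_single i]
    · simp [hi]
    · intro j _ hj
      rw [if_neg]
      intro hkj
      rcases lt_or_gt_of_ne hj with h | h
      · exact lt_irrefl _ (hE.before _ _ h k hkj k hi)
      · exact lt_irrefl _ (hE.before _ _ h k hi k hkj)
    · simp
  · push Not at h
    simp [h]

/-- A seminorm dominated by the `ℓ₁`-norm. -/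
structure IsGood (p : (ℕ+ →₀ ℝ) → ℝ) : Prop where
  nonneg : ∀ x, 0 ≤ p x
  le_l1 : ∀ x, p x ≤ l1 x
  smul : ∀ (c : ℝ) x, p (c • x) = |c| * p x
  add_le : ∀ x y, p (x + y) ≤ p x + p y

theorem isGood_iSup {ι : Type} [Nonempty ι] {p : ι → (ℕ+ →₀ ℝ) → ℝ} (hp : ∀ n, IsGood (p n)) :
    IsGood (fun x => ⨆ n, p n x) := by
  have hb : ∀ x, BddAbove (Set.range fun n => p n x) := fun x =>
    ⟨l1 x, by rintro _ ⟨n, rfl⟩; exact (hp n).le_l1 x⟩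
  refine ⟨fun x => Real.iSup_nonneg fun n => (hp n).nonneg x,
    fun x => ciSup_le fun n => (hp n).le_l1 x, fun c x => ?_, fun x y => ?_⟩
  · simp_rw [(hp _).smul]
    rw [Real.mul_iSup_of_nonneg (abs_nonneg c)]
  · exact ciSup_le fun n => ((hp n).add_le x y).trans
      (add_le_add (le_ciSup (hb x) n) (le_ciSup (hb y) n))

theorem isGood_coord (k : ℕ+) : IsGood (fun x => |x k|) :=
  ⟨fun _ => abs_nonneg _, fun x => abs_le_l1 x k, fun c x => by simp [abs_mul],
    fun x y => abs_add_le _ _⟩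

theorem isGood_max {p q : (ℕ+ →₀ ℝ) → ℝ} (hp : IsGood p) (hq : IsGood q) :
    IsGood (fun x => max (p x) (q x)) := by
  refine ⟨fun x => le_max_of_le_left (hp.nonneg x), fun x => max_le (hp.le_l1 x) (hq.le_l1 x),
    fun c x => ?_, fun x y => ?_⟩
  · simp only [hp.smul, hq.smul]
    rw [mul_max_of_nonneg _ _ (abs_nonneg c)]
  · exact max_le ((hp.add_le x y).trans (add_le_add (le_max_left _ _) (le_max_left _ _)))
      ((hq.add_le x y).trans (add_le_add (le_max_right _ _) (le_max_right _ _)))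

theorem isGood_sum {θ : ℝ} (hθ : θ ∈ Set.Ioc (0 : ℝ) (1 / 2)) {p : (ℕ+ →₀ ℝ) → ℝ} (hp : IsGood p)
    {d : ℕ} {E : Fin d → Finset ℕ+} (hE : Consecutive E) :
    IsGood (fun x => θ * ∑ i, p (proj (E i) x)) := by
  have h0 : 0 ≤ θ := hθ.1.le
  have h1 : θ ≤ 1 := hθ.2.trans (by norm_num)
  refine ⟨fun x => mul_nonneg h0 (Finset.sum_nonneg fun i _ => hp.nonneg _), fun x => ?_,
    fun c x => ?_, fun x y => ?_⟩
  · have hs : ∑ i, p (proj (E i) x) ≤ l1 x :=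
      (Finset.sum_le_sum fun i _ => hp.le_l1 _).trans (sum_l1_proj_le hE x)
    have hn : 0 ≤ ∑ i, p (proj (E i) x) := Finset.sum_nonneg fun i _ => hp.nonneg _
    exact (mul_le_of_le_one_left hn h1).trans hs
  · simp_rw [proj_smul, hp.smul, ← Finset.mul_sum]
    ring
  · rw [← mul_add, ← Finset.sum_add_distrib]
    refine mul_le_mul_of_nonneg_left (Finset.sum_le_sum fun i _ => ?_) h0
    rw [proj_add]
    exact hp.add_le _ _

theorem isGood_zero : IsGood (fun _ => 0) :=
  ⟨fun _ => le_rfl, l1_nonneg, fun _ _ => by simp, fun _ _ => by simp⟩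

theorem isGood_sSup_values {θ : ℝ} (hθ : θ ∈ Set.Ioc (0 : ℝ) (1 / 2)) (F : Set (Finset ℕ+))
    {p : (ℕ+ →₀ ℝ) → ℝ} (hp : IsGood p) : IsGood (fun x => sSup (values θ F p x)) := by
  have key : ∀ x, values θ F p x = Set.range
      (fun e : {e : Σ d : ℕ, Fin d → Finset ℕ+ // Admissible F e.2} =>
        θ * ∑ i, p (proj (e.1.2 i) x)) := by
    intro x
    ext r
    constructor
    · rintro ⟨d, E, hE, rfl⟩
      exact ⟨⟨⟨d, E⟩, hE⟩, rfl⟩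
    · rintro ⟨⟨⟨d, E⟩, hE⟩, rfl⟩
      exact ⟨d, E, hE, rfl⟩
  simp_rw [key]
  rcases isEmpty_or_nonempty {e : Σ d : ℕ, Fin d → Finset ℕ+ // Admissible F e.2} with h | h
  · simp only [Set.range_eq_empty, Real.sSup_empty]
    exact isGood_zero
  · exact isGood_iSup fun e => isGood_sum hθ hp e.2.1

theorem isGood_normSeq {θ : ℝ} (hθ : θ ∈ Set.Ioc (0 : ℝ) (1 / 2)) (F : Set (Finset ℕ+)) (n : ℕ) :
    IsGood (normSeq θ F n) := by
  induction n with
  | zero => exact isGood_iSup isGood_coord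
  | succ n ih => exact isGood_max ih (isGood_sSup_values hθ F ih)

theorem isGood_tsirelsonNorm {θ : ℝ} (hθ : θ ∈ Set.Ioc (0 : ℝ) (1 / 2)) (F : Set (Finset ℕ+)) :
    IsGood (tsirelsonNorm θ F) :=
  isGood_iSup fun n => isGood_normSeq hθ F n

theorem abs_le_tsirelsonNorm {θ : ℝ} (hθ : θ ∈ Set.Ioc (0 : ℝ) (1 / 2)) (F : Set (Finset ℕ+))
    (x : ℕ+ →₀ ℝ) (k : ℕ+) : |x k| ≤ tsirelsonNorm θ F x := by
  have h1 : |x k| ≤ normSeq θ F 0 x :=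
    le_ciSup (f := fun k => |x k|) ⟨l1 x, by rintro _ ⟨n, rfl⟩; exact abs_le_l1 x n⟩ k
  exact h1.trans (le_ciSup (f := fun n => normSeq θ F n x)
    ⟨l1 x, by rintro _ ⟨n, rfl⟩; exact (isGood_normSeq hθ F n).le_l1 x⟩ 0)

/-- The vector space `c₀₀`, to be normed by `tsirelsonNorm θ F`. -/
def C00 (θ : ℝ) (_ : θ ∈ Set.Ioc (0 : ℝ) (1 / 2)) (_ : Set (Finset ℕ+)) : Type := ℕ+ →₀ ℝ

variable (θ : ℝ) (hθ : θ ∈ Set.Ioc (0 : ℝ) (1 / 2)) (F : Set (Finset ℕ+))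

instance : AddCommGroup (C00 θ hθ F) := inferInstanceAs (AddCommGroup (ℕ+ →₀ ℝ))

instance : Module ℝ (C00 θ hθ F) := inferInstanceAs (Module ℝ (ℕ+ →₀ ℝ))

instance : Norm (C00 θ hθ F) := ⟨tsirelsonNorm θ F⟩

theorem C00.core : NormedSpace.Core ℝ (C00 θ hθ F) where
  norm_nonneg x := (isGood_tsirelsonNorm hθ F).nonneg x
  norm_smul c x := (isGood_tsirelsonNorm hθ F).smul c x
  norm_triangle x y := (isGood_tsirelsonNorm hθ F).add_le x y
  norm_eq_zero_iff x := by
    constructor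
    · intro h
      refine Finsupp.ext fun k => ?_
      have h1 := abs_le_tsirelsonNorm hθ F x k
      have h2 : tsirelsonNorm θ F x = 0 := h
      rw [h2] at h1
      exact abs_nonpos_iff.mp h1
    · rintro rfl
      have h := (isGood_tsirelsonNorm hθ F).smul 0 0
      rw [zero_smul, abs_zero, zero_mul] at h
      exact h

instance : NormedAddCommGroup (C00 θ hθ F) := NormedAddCommGroup.ofCore (C00.core θ hθ F)

instance : NormedSpace ℝ (C00 θ hθ F) := NormedSpace.ofCore (C00.core θ hθ F)

/-- The Banach space `T[θ, F]`: the completion of `c₀₀`. -/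
abbrev Space : Type := UniformSpace.Completion (C00 θ hθ F)

/-- The unit vectors of `c₀₀`, as elements of `T[θ, F]`. -/
def unitVec (k : ℕ+) : Space θ hθ F :=
  ((show C00 θ hθ F from Finsupp.single k (1 : ℝ)) : UniformSpace.Completion (C00 θ hθ F))

end Tsirelson

end

open Tsirelson

/-! The norm satisfies the implicit equation $\|x\|=\max\{\|x\|_\infty,\sup\theta\sum\|E_ix\|\}$ and
depends only on the moduli of the coordinates. The Schreier families involved are closed under
subsets and spreads and contain $\mathcal S_1$. The proof shows that $U$ sends each $e_i$ to some
$\pm e_{\pi(i)}$, that it then acts coordinatewise, and that $\pi$ preserves the large members of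
$\mathcal S_\alpha$.

Faces. Adding $ce_i$ to a vector is felt either in coordinate $i$ or with weight $\theta\le\frac12$,
so $y\in\mathbb S$ is at distance $2$ from $se_i$ ($s=\pm1$) only if $y_i=-s$. Hence, once $U(\tau
e_i)$ has some coordinate $j$ equal to $\sigma=\pm1$, $U$ maps the face $y_i=\tau$ onto the face
$y_j=\sigma$. Each face is symmetric about its centre, and isometries preserve such centres (a
Mazur–Ulam argument), so $U(\tau e_i)=\sigma e_j$ (`map_vertex`).

A coordinate of modulus one. If $\|p\|=1$ and all $|p_k|<1$, then $p$ stays at distance at least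
some $c>1$ from the late terms of any normalized coordinatewise null family
(`exists_gt_one_eventually_le`): a nearly norming admissible family for a suitable tail of $p$ has a
last set on which that tail has norm below one, and that set can be moved onto the null family,
where norm about one is gained. The vectors $U(e_k)$ are mutually at distance $1$. Subtracting their
coordinatewise ultrafilter limit $w$ gives a normalized null family at mutual distance $1$, so each
difference has a coordinate of modulus one. Since $\theta^{-1}=N$ is an integer, sign vectors of
length $N$ are normalized, and testing against their preimages gives $w_n=0$ for $n>N$. So $U(e_k)$
itself has a coordinate of modulus one for most $k$; comparing with $U^{-1}$ extends this to every
$k$ (`exists_map_vertex_eq`).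

Rigidity. Distances to points of an opposite face give $(Uy)_{\pi(i)}=\varepsilon_iy_i$
(`mul_coord_map_eq`), so $U$ extends linearly. For $|A|>N$, the indicator of $A$ has norm
$\theta|A|$ exactly when $A$ is in the family, so $\pi$ preserves membership of such sets
(`mem_iff_of_perm`). For $\alpha=1$, maximal sets $[i,2i)$ force $\pi(i)=i$ beyond $N$. For
$\alpha>1$, any two coordinates are separated by arbitrarily large sets (`exists_separating`), which
makes $\pi$ increasing and therefore the identity. -/

namespace Tsirelson

/-! ### Combinatorics of the Schreier families -/

/-- A family of finite sets closed under passing to subsets and to spreads. -/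
def Regular (F : Set (Finset ℕ+)) : Prop :=
  ∀ (A G : Finset ℕ+) (m : ℕ+ → ℕ+), G ∈ F → StrictMonoOn m A →
    (∀ a ∈ A, m a ≤ a ∧ m a ∈ G) → A ∈ F

theorem Regular.subset {F : Set (Finset ℕ+)} (hF : Regular F) {A G : Finset ℕ+} (hG : G ∈ F)
    (h : A ⊆ G) : A ∈ F :=
  hF A G id hG (strictMono_id.strictMonoOn _) fun _ ha => ⟨le_rfl, h ha⟩

/-- Replacing an element by a larger one that keeps its rank preserves membership. -/
theorem Regular.replace {F : Set (Finset ℕ+)} (hF : Regular F) {A : Finset ℕ+} {i j : ℕ+}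
    (hij : i ≤ j) (hA : ∀ a ∈ A, a < i ∨ j < a) (h : insert i A ∈ F) : insert j A ∈ F := by
  have hjA : ∀ a ∈ A, a ≠ j := by
    intro a ha h
    rcases hA a ha with h1 | h1
    · exact absurd (h ▸ h1) (not_lt.mpr hij)
    · exact h1.ne h.symm
  refine hF _ _ (Function.update id j i) h ?_ ?_
  · intro a ha b hb hab
    rw [Finset.mem_coe, Finset.mem_insert] at ha hb
    rcases ha with rfl | ha <;> rcases hb with rfl | hb
    · exact absurd hab (lt_irrefl _)
    · rw [Function.update_self, Function.update_of_ne (hjA b hb)]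
      exact hij.trans_lt hab
    · rw [Function.update_self, Function.update_of_ne (hjA a ha)]
      exact (hA a ha).resolve_right (not_lt.mpr hab.le)
    · rw [Function.update_of_ne (hjA b hb), Function.update_of_ne (hjA a ha)]
      exact hab
  · intro a ha
    rw [Finset.mem_insert] at ha
    rcases ha with rfl | ha
    · simp [hij]
    · rw [Function.update_of_ne (hjA a ha)]
      simp [ha]

theorem empty_mem_schreier (β : Ordinal.{0} → ℕ+ → Ordinal.{0}) (α : Ordinal.{0}) :
    ∅ ∈ schreier β α := by
  induction α using Ordinal.limitRecOn with
  | zero => simp [schreier_zero]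
  | add_one α _ => simp [schreier_add_one]
  | limit l hl _ => simp [schreier_limit _ _ hl]

/-- Membership in the successor family in terms of a monotone labelling of the pieces. -/
theorem mem_schreier_add_one (β : Ordinal.{0} → ℕ+ → Ordinal.{0}) (α : Ordinal.{0})
    (G : Finset ℕ+) : G ∈ schreier β (α + 1) ↔ ∃ (d : ℕ) (f : ℕ+ → ℕ), MonotoneOn f G ∧
      (∀ k ∈ G, f k < d) ∧ (∀ k ∈ G, d ≤ (k : ℕ)) ∧
      ∀ j, G.filter (fun k => f k = j) ∈ schreier β α := by
  rw [schreier_add_one]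
  constructor
  · rintro (⟨d, B, hB, hS, hd, rfl⟩ | h)
    · classical
      have hdisj : ∀ i j k, k ∈ B i → k ∈ B j → i = j := by
        intro i j k hi hj
        rcases lt_trichotomy i j with h | h | h
        · exact absurd (hB.before _ _ h k hi k hj) (lt_irrefl _)
        · exact h
        · exact absurd (hB.before _ _ h k hj k hi) (lt_irrefl _)
      let f : ℕ+ → ℕ := fun k => if h : ∃ i, k ∈ B i then (h.choose : ℕ) else 0
      have hf : ∀ i k, k ∈ B i → f k = i := by
        intro i k hk
        have h : ∃ i, k ∈ B i := ⟨i, hk⟩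
        simp only [f, dif_pos h]
        rw [hdisj _ _ k h.choose_spec hk]
      have hmem : ∀ k, k ∈ Finset.univ.biUnion B ↔ ∃ i, k ∈ B i := by simp
      refine ⟨d, f, ?_, ?_, hd, ?_⟩
      · intro a ha b hb hab
        obtain ⟨i, hi⟩ := (hmem a).1 ha
        obtain ⟨j, hj⟩ := (hmem b).1 hb
        rw [hf i a hi, hf j b hj]
        by_contra hlt
        have := hB.before j i (by rw [Fin.lt_def]; omega) b hj a hi
        exact absurd this (not_lt.mpr hab)
      · intro k hk
        obtain ⟨i, hi⟩ := (hmem k).1 hk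
        rw [hf i k hi]
        exact i.2
      · intro j
        by_cases hj : j < d
        · convert hS ⟨j, hj⟩ using 1
          ext k
          rw [Finset.mem_filter, hmem]
          constructor
          · rintro ⟨⟨i, hi⟩, hk⟩
            rw [hf i k hi] at hk
            have : i = ⟨j, hj⟩ := Fin.ext hk
            rwa [← this]
          · intro hk
            exact ⟨⟨_, hk⟩, hf _ k hk⟩
        · convert empty_mem_schreier β α using 1
          rw [Finset.filter_eq_empty_iff]
          intro k hk
          obtain ⟨i, hi⟩ := (hmem k).1 hk
          rw [hf i k hi]
          have := i.2
          omega
    · rw [Set.mem_singleton_iff] at h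
      subst h
      exact ⟨0, fun _ => 0, by simp [MonotoneOn], by simp, by simp,
        fun j => by simpa using empty_mem_schreier β α⟩
  · rintro ⟨d, f, hmono, hlt, hle, hfib⟩
    left
    set I := G.image f with hI
    have hcard : I.card ≤ d := by
      have : I ⊆ Finset.range d := by
        intro j hj
        obtain ⟨k, hk, rfl⟩ := Finset.mem_image.1 hj
        exact Finset.mem_range.2 (hlt k hk)
      simpa using Finset.card_le_card this
    let g := I.orderEmbOfFin rfl
    refine ⟨I.card, fun i => G.filter (fun k => f k = g i), ⟨fun i => ?_, ?_⟩, fun i => hfib _,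
      fun k hk => hcard.trans (hle k hk), ?_⟩
    · have : g i ∈ I := Finset.orderEmbOfFin_mem _ _ _
      obtain ⟨k, hk, hk'⟩ := Finset.mem_image.1 this
      exact ⟨k, Finset.mem_filter.2 ⟨hk, hk'⟩⟩
    · intro i j hij a ha b hb
      rw [Finset.mem_filter] at ha hb
      by_contra h
      have h1 := hmono hb.1 ha.1 (not_lt.1 h)
      rw [ha.2, hb.2] at h1
      exact absurd (g.lt_iff_lt.2 hij) (not_lt.mpr h1)
    · ext k
      simp only [Finset.mem_biUnion, Finset.mem_univ, true_and, Finset.mem_filter]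
      constructor
      · intro hk
        have : f k ∈ Set.range g := by
          rw [Finset.range_orderEmbOfFin]
          exact Finset.mem_coe.2 (Finset.mem_image_of_mem _ hk)
        obtain ⟨i, hi⟩ := this
        exact ⟨i, hk, hi.symm⟩
      · rintro ⟨_, hk, _⟩
        exact hk

theorem mem_schreier_limit (β : Ordinal.{0} → ℕ+ → Ordinal.{0}) {l : Ordinal.{0}}
    (hl : Order.IsSuccLimit l) (hβ : ∀ n, β l n + 1 < l) (G : Finset ℕ+) :
    G ∈ schreier β l ↔ ∃ n : ℕ+, G ∈ schreier β (β l n + 1) ∧ ∀ k ∈ G, n ≤ k := by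
  rw [schreier_limit _ _ hl]
  constructor
  · rintro (⟨n, _, h⟩ | h)
    · exact ⟨n, h⟩
    · rw [Set.mem_singleton_iff] at h
      subst h
      exact ⟨1, empty_mem_schreier _ _, by simp⟩
  · rintro ⟨n, h⟩
    exact Or.inl ⟨n, hβ n, h⟩

/-- A labelling of $G$ pulls back along $m$ to a labelling of $A$; the lower bounds on elements
survive because $m(a)\le a$. -/
theorem regular_schreier {β : Ordinal.{0} → ℕ+ → Ordinal.{0}} (hβ : IsLadder β)
    (α : Ordinal.{0}) (hα : α < ω₁) : Regular (schreier β α) := by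
  induction α using Ordinal.limitRecOn with
  | zero =>
    intro A G m hG hm h
    rw [schreier_zero] at hG ⊢
    exact (Finset.card_le_card_of_injOn m (fun a ha => (h a ha).2) hm.injOn).trans hG
  | add_one α ih =>
    intro A G m hG hm h
    rw [mem_schreier_add_one] at hG ⊢
    obtain ⟨d, f, h1, h2, h3, h4⟩ := hG
    refine ⟨d, f ∘ m, ?_, fun k hk => h2 _ (h k hk).2, fun k hk => ?_, fun j => ?_⟩
    · intro a ha b hb hab
      exact h1 (h a ha).2 (h b hb).2 (hm.monotoneOn ha hb hab)
    · exact (h3 _ (h k hk).2).trans (PNat.coe_le_coe _ _ |>.2 (h k hk).1)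
    · refine ih ((Order.lt_add_one_iff.2 le_rfl : α < α + 1).trans hα) _ _ m (h4 j)
        (hm.mono (Finset.coe_subset.2 (Finset.filter_subset _ _))) fun a ha => ?_
      rw [Finset.mem_filter] at ha
      exact ⟨(h a ha.1).1, Finset.mem_filter.2 ⟨(h a ha.1).2, ha.2⟩⟩
  | limit l hl ih =>
    intro A G m hG hm h
    rw [mem_schreier_limit _ hl (hβ.lt l hα hl)] at hG ⊢
    obtain ⟨n, h1, h2⟩ := hG
    exact ⟨n, ih _ (hβ.lt l hα hl n) ((hβ.lt l hα hl n).trans hα) A G m h1 hm h,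
      fun k hk => (h2 _ (h k hk).2).trans (h k hk).1⟩

theorem mem_schreier_one (β : Ordinal.{0} → ℕ+ → Ordinal.{0}) (G : Finset ℕ+) :
    G ∈ schreier β 1 ↔ ∀ k ∈ G, G.card ≤ (k : ℕ) := by
  have h01 : (1 : Ordinal.{0}) = 0 + 1 := by simp
  rw [h01, mem_schreier_add_one]
  constructor
  · rintro ⟨d, f, h1, h2, h3, h4⟩ k hk
    refine le_trans ?_ (h3 k hk)
    have : (G.image f).card = G.card := by
      refine Finset.card_image_of_injOn fun a ha b hb hab => ?_
      have h := h4 (f a)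
      rw [schreier_zero, Set.mem_ofPred_eq, Finset.card_le_one] at h
      exact h a (Finset.mem_filter.2 ⟨ha, rfl⟩) b (Finset.mem_filter.2 ⟨hb, hab.symm⟩)
    rw [← this]
    have h5 : G.image f ⊆ Finset.range d := by
      intro j hj
      obtain ⟨k, hk, rfl⟩ := Finset.mem_image.1 hj
      exact Finset.mem_range.2 (h2 k hk)
    simpa using Finset.card_le_card h5
  · intro h
    -- Each element is labelled by its rank in `G`, so that the pieces are singletons.
    refine ⟨G.card, fun k => (G.filter (· < k)).card, ?_, fun k hk => ?_, h, fun j => ?_⟩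
    · intro a _ b _ hab
      exact Finset.card_le_card fun c hc => by
        rw [Finset.mem_filter] at hc ⊢
        exact ⟨hc.1, hc.2.trans_le hab⟩
    · refine Finset.card_lt_card (Finset.filter_ssubset.2 ⟨k, hk, lt_irrefl k⟩)
    · rw [schreier_zero, Set.mem_ofPred_eq, Finset.card_le_one]
      have key : ∀ a ∈ G, ∀ b ∈ G, a < b →
          (G.filter (· < a)).card < (G.filter (· < b)).card := by
        intro a ha b hb hab
        refine Finset.card_lt_card ⟨fun c hc => ?_, fun h => ?_⟩
        · rw [Finset.mem_filter] at hc ⊢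
          exact ⟨hc.1, hc.2.trans hab⟩
        · have := h (Finset.mem_filter.2 ⟨ha, hab⟩)
          exact lt_irrefl _ (Finset.mem_filter.1 this).2
      intro a ha b hb
      rw [Finset.mem_filter] at ha hb
      dsimp only at ha hb
      rcases lt_trichotomy a b with h | h | h
      · have := key a ha.1 b hb.1 h; omega
      · exact h
      · have := key b hb.1 a ha.1 h; omega

theorem schreier_subset_add_one (β : Ordinal.{0} → ℕ+ → Ordinal.{0}) (α : Ordinal.{0}) :
    schreier β α ⊆ schreier β (α + 1) := by
  intro G hG
  rw [mem_schreier_add_one]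
  refine ⟨1, fun _ => 0, by simp [MonotoneOn], by simp, fun k _ => k.2, fun j => ?_⟩
  by_cases hj : 0 = j
  · simpa [hj] using hG
  · simpa [hj] using empty_mem_schreier β α

/-- This makes every $\mathcal S_1$-set of minima admissible for the norm of order $\alpha$. At a
limit the first member of the sequence suffices, since $1\le\min G$ is no restriction. -/
theorem schreier_one_subset {β : Ordinal.{0} → ℕ+ → Ordinal.{0}} (hβ : IsLadder β)
    (α : Ordinal.{0}) (h1 : 1 ≤ α) (hα : α < ω₁) :
    schreier β 1 ⊆ schreier β α := by
  induction α using Ordinal.limitRecOn with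
  | zero => simp at h1
  | add_one α ih =>
    rcases eq_or_ne α 0 with rfl | h
    · simp
    · exact (ih (Order.one_le_iff_ne_zero.2 h)
        ((Order.lt_add_one_iff.2 le_rfl : α < α + 1).trans hα)).trans
        (schreier_subset_add_one _ _)
  | limit l hl ih =>
    intro G hG
    rw [mem_schreier_limit _ hl (hβ.lt l hα hl)]
    refine ⟨1, ih _ (hβ.lt l hα hl 1) ?_ ((hβ.lt l hα hl 1).trans hα) hG, fun k _ => one_le⟩
    simp

/-- Long intervals do not belong to a Schreier family. -/
theorem exists_Ico_notMem {β : Ordinal.{0} → ℕ+ → Ordinal.{0}} (hβ : IsLadder β)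
    (α : Ordinal.{0}) (hα : α < ω₁) (L : ℕ+) : ∃ t, L < t ∧ Finset.Ico L t ∉ schreier β α := by
  induction α using Ordinal.limitRecOn generalizing L with
  | zero =>
    refine ⟨L + 2, PNat.lt_add_right L 2, ?_⟩
    rw [schreier_zero, Set.mem_ofPred_eq, PNat.card_Ico]
    simp
  | add_one α ih =>
    have hα' : α < ω₁ := (Order.lt_add_one_iff.2 le_rfl : α < α + 1).trans hα
    choose g hg1 hg2 using ih hα'
    have hLr : ∀ r : ℕ, L ≤ g^[r] L := by
      intro r
      induction r with
      | zero => exact le_rfl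
      | succ r ihr =>
        rw [Function.iterate_succ_apply']
        exact ihr.trans (hg1 _).le
    -- This interval consists of `L` successive blocks, none of them in $\mathcal S_\alpha$. A
    -- monotone labelling cannot be constant on a block, so its last label is at least `L`; but
    -- labels are below `d`, and `d ≤ L`.
    refine ⟨g^[(L : ℕ)] L, ?_, ?_⟩
    · obtain ⟨r, hr⟩ : ∃ r : ℕ, (L : ℕ) = r + 1 := ⟨L - 1, by have := L.pos; omega⟩
      rw [hr, Function.iterate_succ_apply']
      exact (hLr r).trans_lt (hg1 _)
    · rw [mem_schreier_add_one]
      rintro ⟨d, f, h1, h2, h3, h4⟩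
      have key : ∀ r : ℕ, r ≤ L → ∀ k ∈ Finset.Ico L (g^[(L : ℕ)] L),
          g^[r] L ≤ k + 1 → r ≤ f k := by
        intro r
        induction r with
        | zero => simp
        | succ r ihr =>
          intro hr k hk hle
          rw [Function.iterate_succ_apply'] at hle
          by_contra hcon
          set s := g^[r] L with hs
          have hsub : ∀ c ∈ Finset.Ico s (g s), c ≤ k := by
            intro c hc
            have := (Finset.mem_Ico.1 hc).2
            exact PNat.lt_add_one_iff.1 (this.trans_le hle)
          have hmem : ∀ c ∈ Finset.Ico s (g s), c ∈ Finset.Ico L (g^[(L : ℕ)] L) := by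
            intro c hc
            exact Finset.mem_Ico.2 ⟨(hLr r).trans (Finset.mem_Ico.1 hc).1,
              (hsub c hc).trans_lt (Finset.mem_Ico.1 hk).2⟩
          have hfc : ∀ c ∈ Finset.Ico s (g s), f c = r := by
            intro c hc
            have hu := h1 (hmem c hc) hk (hsub c hc)
            have hl := ihr (by omega) c (hmem c hc)
              ((Finset.mem_Ico.1 hc).1.trans (PNat.lt_add_right c 1).le)
            omega
          refine hg2 s ((regular_schreier hβ α hα').subset (h4 r) fun c hc => ?_)
          exact Finset.mem_filter.2 ⟨hmem c hc, hfc c hc⟩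
      obtain ⟨r, hr⟩ : ∃ r : ℕ, (L : ℕ) = r + 1 := ⟨L - 1, by have := L.pos; omega⟩
      have hlt : L < g^[(L : ℕ)] L := by
        rw [hr, Function.iterate_succ_apply']
        exact (hLr r).trans_lt (hg1 _)
      obtain ⟨k, hk⟩ : ∃ k, g^[(L : ℕ)] L = k + 1 := by
        have h : (1 : ℕ+) < g^[(L : ℕ)] L := one_le.trans_lt hlt
        exact ⟨g^[(L : ℕ)] L - 1, (PNat.sub_add_of_lt h).symm⟩
      have hkm : k ∈ Finset.Ico L (g^[(L : ℕ)] L) := by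
        rw [Finset.mem_Ico, hk]
        rw [hk] at hlt
        exact ⟨PNat.lt_add_one_iff.1 hlt, PNat.lt_add_right k 1⟩
      have h5 := key L le_rfl k hkm hk.le
      have h6 := h2 k hkm
      have h7 := h3 L (Finset.mem_Ico.2 ⟨le_rfl, hlt⟩)
      omega
  | limit l hl ih =>
    have hlt := hβ.lt l hα hl
    choose g hg1 hg2 using fun n => ih _ (hlt n) ((hlt n).trans hα) L
    have hne : (Finset.Icc 1 L).Nonempty := ⟨1, by simp⟩
    -- Only indices `n ≤ L` can witness membership of a set with minimum `L`, so the largest of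
    -- finitely many endpoints works.
    refine ⟨(Finset.Icc 1 L).sup' hne g, (hg1 1).trans_le (Finset.le_sup' g (by simp)), ?_⟩
    rw [mem_schreier_limit _ hl hlt]
    rintro ⟨n, h1, h2⟩
    have hL : L < (Finset.Icc 1 L).sup' hne g := (hg1 1).trans_le (Finset.le_sup' g (by simp))
    have hn := h2 L (Finset.mem_Ico.2 ⟨le_rfl, hL⟩)
    refine hg2 n ((regular_schreier hβ _ ((hlt n).trans hα)).subset h1 ?_)
    exact Finset.Ico_subset_Ico_right (Finset.le_sup' g (by simp [hn]))

/-- The members of `schreier β α` with a prescribed element `i`, compared with unions of members of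
a lower family. -/
theorem exists_lower_family {β : Ordinal.{0} → ℕ+ → Ordinal.{0}} (hβ : IsLadder β)
    (α : Ordinal.{0}) (h1 : 1 < α) (hα : α < ω₁) (i : ℕ+) (hi : 1 < i) :
    ∃ γ : Ordinal.{0}, 1 ≤ γ ∧ γ < ω₁ ∧
      (∀ G : Finset ℕ+, i ∈ G → G ∈ schreier β α → ∃ f : ℕ+ → ℕ, MonotoneOn f G ∧
        (∀ k ∈ G, f k < i) ∧ ∀ c, G.filter (fun k => f k = c) ∈ schreier β γ) ∧
      ∀ (G : Finset ℕ+) (d : ℕ) (f : ℕ+ → ℕ), (∀ k ∈ G, i ≤ k) → (∀ k ∈ G, d ≤ (k : ℕ)) →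
        MonotoneOn f G → (∀ k ∈ G, f k < d) →
        (∀ c, G.filter (fun k => f k = c) ∈ schreier β γ) → G ∈ schreier β α := by
  rcases Ordinal.zero_or_succ_or_isSuccLimit α with rfl | ⟨γ, rfl⟩ | hl
  · simp at h1
  · have hγ : γ < γ + 1 := Order.lt_add_one_iff.2 le_rfl
    refine ⟨γ, Order.lt_add_one_iff.1 h1, hγ.trans hα, fun G hiG hG => ?_, ?_⟩
    · obtain ⟨d, f, f1, f2, f3, f4⟩ := (mem_schreier_add_one _ _ _).1 hG
      exact ⟨f, f1, fun k hk => (f2 k hk).trans_le (f3 i hiG), f4⟩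
    · intro G d f _ hd f1 f2 f3
      exact (mem_schreier_add_one _ _ _).2 ⟨d, f, f1, f2, hd, f3⟩
  · have hlt := hβ.lt α hα hl
    have hγ : β α i < ω₁ := (Order.lt_add_one_iff.2 le_rfl : β α i < β α i + 1).trans
      ((hlt i).trans hα)
    have hsub : ∀ m n, m ≤ n → schreier β (β α m) ⊆ schreier β (β α n) := by
      intro m n
      induction n using PNat.recOn with
      | one => intro h; rw [le_antisymm h one_le]
      | succ n ih =>
        intro h
        rcases eq_or_lt_of_le h with rfl | h
        · exact subset_rfl
        · exact (ih (PNat.lt_add_one_iff.1 h)).trans (hβ.subset α hα hl n)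
    -- A witness `n` for a set containing `i` satisfies `n ≤ i`, so its pieces lie in the family of
    -- order `β α i`. Conversely, sets bounded below by `i` may use `i` itself as witness. Strict
    -- monotonicity and `1 < i` give `β α i ≠ 0`.
    refine ⟨β α i, ?_, hγ, fun G hiG hG => ?_, ?_⟩
    · rw [Order.one_le_iff_ne_zero]
      exact (zero_le.trans_lt (hβ.strictMono α hα hl hi)).ne'
    · obtain ⟨n, hn, hmin⟩ := (mem_schreier_limit _ hl hlt _).1 hG
      obtain ⟨d, f, f1, f2, f3, f4⟩ := (mem_schreier_add_one _ _ _).1 hn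
      exact ⟨f, f1, fun k hk => (f2 k hk).trans_le (f3 i hiG),
        fun c => hsub _ _ (hmin i hiG) (f4 c)⟩
    · intro G d f hi hd f1 f2 f3
      exact (mem_schreier_limit _ hl hlt _).2
        ⟨i, (mem_schreier_add_one _ _ _).2 ⟨d, f, f1, f2, hd, f3⟩, hi⟩

/-- Two pieces, the singleton of `i` and the interval, both in $\mathcal S_1$, are enough; two are
allowed because every element is at least $2$. This supplies the arbitrarily large sets in
`exists_separating`. -/
theorem insert_Ico_mem {β : Ordinal.{0} → ℕ+ → Ordinal.{0}} (hβ : IsLadder β)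
    {α : Ordinal.{0}} (h1 : 1 < α) (hα : α < ω₁) {i L n : ℕ+} (hi : 1 < i) (hiL : i < L)
    (hn : n ≤ L) : insert i (Finset.Ico L (L + n)) ∈ schreier β α := by
  obtain ⟨γ, hγ1, hγ, -, h⟩ := exists_lower_family hβ α h1 hα i hi
  have hS := schreier_one_subset hβ γ hγ1 hγ
  have hge : ∀ k ∈ insert i (Finset.Ico L (L + n)), i ≤ k := by
    intro k hk
    rw [Finset.mem_insert, Finset.mem_Ico] at hk
    rcases hk with rfl | hk
    · exact le_rfl
    · exact hiL.le.trans hk.1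
  refine h _ 2 (fun k => if L ≤ k then 1 else 0) hge (fun k hk => ?_) ?_ ?_ ?_
  · have : (1 : ℕ+) < k := hi.trans_le (hge k hk)
    exact_mod_cast PNat.coe_lt_coe _ _ |>.2 this
  · intro a _ b _ hab
    dsimp only
    split_ifs with ha hb
    · exact le_rfl
    · exact absurd (ha.trans hab) hb
    · simp
    · exact le_rfl
  · intro k _
    split_ifs <;> simp
  · intro c
    apply hS
    rw [mem_schreier_one]
    intro k hk
    have hc : c = if L ≤ k then 1 else 0 := (Finset.mem_filter.1 hk).2.symm
    by_cases hL : L ≤ k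
    · rw [if_pos hL] at hc
      subst hc
      have : (insert i (Finset.Ico L (L + n))).filter (fun k => (if L ≤ k then 1 else 0) = 1) ⊆
          Finset.Ico L (L + n) := by
        intro a ha
        simp only [Finset.mem_filter, Finset.mem_insert] at ha
        rcases ha with ⟨rfl | ha, h2⟩
        · simp [not_le.2 hiL] at h2
        · exact ha
      refine (Finset.card_le_card this).trans ?_
      rw [PNat.card_Ico]
      have h3 : (n : ℕ) ≤ L := hn
      have h4 : (L : ℕ) ≤ k := hL
      rw [PNat.add_coe]
      omega
    · rw [if_neg hL] at hc
      subst hc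
      have : (insert i (Finset.Ico L (L + n))).filter (fun k => (if L ≤ k then 1 else 0) = 0) ⊆
          {i} := by
        intro a ha
        simp only [Finset.mem_filter, Finset.mem_insert, Finset.mem_Ico] at ha
        rcases ha with ⟨rfl | ha, h2⟩
        · simp
        · simp [ha.1] at h2
      exact (Finset.card_le_card this).trans k.pos

/-- An element $1$ allows at most one piece at each successor step, so the set descends to $\mathcal
S_0$. -/
theorem card_le_one_of_one_mem {β : Ordinal.{0} → ℕ+ → Ordinal.{0}} (hβ : IsLadder β)
    {α : Ordinal.{0}} (hα : α < ω₁) {G : Finset ℕ+} (hG : G ∈ schreier β α) (h1 : 1 ∈ G) :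
    G.card ≤ 1 := by
  induction α using Ordinal.limitRecOn generalizing G with
  | zero => rwa [schreier_zero] at hG
  | add_one α ih =>
    obtain ⟨d, f, f1, f2, f3, f4⟩ := (mem_schreier_add_one _ _ _).1 hG
    have hd : d ≤ 1 := f3 1 h1
    have : G.filter (fun k => f k = 0) = G :=
      Finset.filter_true_of_mem fun k hk => by have := f2 k hk; omega
    have h := f4 0
    rw [this] at h
    exact ih ((Order.lt_add_one_iff.2 le_rfl : α < α + 1).trans hα) h h1
  | limit l hl ih =>
    obtain ⟨n, hn, -⟩ := (mem_schreier_limit _ hl (hβ.lt l hα hl) _).1 hG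
    exact ih _ (hβ.lt l hα hl n) ((hβ.lt l hα hl n).trans hα) hn h1

/-- For `1 < α` the family `schreier β α` separates any two coordinates. -/
theorem exists_separating {β : Ordinal.{0} → ℕ+ → Ordinal.{0}} (hβ : IsLadder β)
    {α : Ordinal.{0}} (h1 : 1 < α) (hα : α < ω₁) (n : ℕ+) {i j : ℕ+} (hij : i < j) :
    ∃ A : Finset ℕ+, (∀ a ∈ A, j < a) ∧ (n : ℕ) ≤ A.card ∧ insert j A ∈ schreier β α ∧
      insert i A ∉ schreier β α := by
  have hreg := regular_schreier hβ α hα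
  have hi1 : 1 < i + 1 := PNat.lt_add_left 1 i
  have hij' : i + 1 ≤ j := PNat.add_one_le_iff.2 hij
  set L := j + n with hL
  have hjL : j < L := PNat.lt_add_right j n
  have hnL : n ≤ L := (PNat.lt_add_left n j).le
  have hbase := insert_Ico_mem hβ h1 hα hi1 (hij'.trans_lt hjL) hnL
  have hmemL : ∀ t, ∀ a ∈ Finset.Ico L t, j < a := fun t a ha =>
    hjL.trans_le (Finset.mem_Ico.1 ha).1
  have hup : ∀ t, insert (i + 1) (Finset.Ico L t) ∈ schreier β α →
      insert j (Finset.Ico L t) ∈ schreier β α := fun t ht =>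
    hreg.replace hij' (fun a ha => Or.inr (hmemL t a ha)) ht
  have hcard : ∀ t, L + n ≤ t → (n : ℕ) ≤ (Finset.Ico L t).card := by
    intro t ht
    rw [PNat.card_Ico]
    have : (L + n : ℕ) ≤ t := ht
    omega
  rcases eq_or_lt_of_le (one_le : 1 ≤ i) with rfl | hi
  · refine ⟨_, hmemL _, hcard _ le_rfl, hup _ hbase, fun h => ?_⟩
    have h2 := card_le_one_of_one_mem hβ hα h (Finset.mem_insert_self _ _)
    rw [Finset.card_insert_of_notMem] at h2
    · have := hcard _ le_rfl
      have := n.pos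
      omega
    · intro h3
      exact absurd (hij.trans (hmemL _ _ h3)) (lt_irrefl _)
  have hex : ∃ t, insert (i + 1) (Finset.Ico L t) ∉ schreier β α := by
    obtain ⟨t, -, ht⟩ := exists_Ico_notMem hβ α hα L
    exact ⟨t, fun h => ht (hreg.subset h (Finset.subset_insert _ _))⟩
  classical
  -- The interval is taken as long as possible: `insert (i + 1) (Finset.Ico L t)` is in the family,
  -- but adding the one further point `t` destroys membership.
  obtain ⟨s, hs, hmin⟩ : ∃ s, insert (i + 1) (Finset.Ico L s) ∉ schreier β α ∧
      ∀ t < s, insert (i + 1) (Finset.Ico L t) ∈ schreier β α :=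
    ⟨PNat.find hex, PNat.find_spec hex, fun t ht => not_not.1 (PNat.find_min hex ht)⟩
  have hLs : L + n < s := by
    by_contra hcon
    exact hs (hreg.subset hbase (Finset.insert_subset_insert _
      (Finset.Ico_subset_Ico_right (not_lt.1 hcon))))
  obtain ⟨t, rfl⟩ : ∃ t, s = t + 1 :=
    ⟨s - 1, (PNat.sub_add_of_lt (one_le.trans_lt hLs)).symm⟩
  have hLt : L + n ≤ t := PNat.lt_add_one_iff.1 hLs
  refine ⟨Finset.Ico L t, hmemL _, hcard _ hLt, hup _ (hmin t (PNat.lt_add_right t 1)),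
    fun hcon => hs ?_⟩
  obtain ⟨γ, hγ1, hγ, hdown, hbuild⟩ := exists_lower_family hβ α h1 hα i hi
  obtain ⟨f, f1, f2, f3⟩ := hdown _ (Finset.mem_insert_self _ _) hcon
  have hregγ := regular_schreier hβ γ hγ
  have hiG : i ∈ insert i (Finset.Ico L t) := Finset.mem_insert_self _ _
  have hiL : i + 1 < L := hij'.trans_lt hjL
  have hit : i + 1 < t := hiL.trans ((PNat.lt_add_right L n).trans_le hLt)
  -- If `insert i (Finset.Ico L t)` were in the family, with labels below `i`, then `i + 1` could
  -- inherit the label of `i` and `t` could form a new piece labelled `i`. That is `i + 1` pieces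
  -- with minimum `i + 1`, contradicting the choice of `t`.
  let g : ℕ+ → ℕ := fun k => if k = i + 1 then f i else if k = t then i else f k
  have g1 : g (i + 1) = f i := if_pos rfl
  have g2 : g t = i := by simp [g, hit.ne']
  have g3 : ∀ k ∈ Finset.Ico L t, g k = f k := by
    intro k hk
    have hk := Finset.mem_Ico.1 hk
    simp [g, (hiL.trans_le hk.1).ne', hk.2.ne]
  have hcases : ∀ k ∈ insert (i + 1) (Finset.Ico L (t + 1)),
      k = i + 1 ∨ k ∈ Finset.Ico L t ∨ k = t := by
    intro k hk
    rw [Finset.mem_insert, Finset.mem_Ico, PNat.lt_add_one_iff] at hk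
    rw [Finset.mem_Ico]
    rcases hk with h | h
    · exact Or.inl h
    · rcases eq_or_lt_of_le h.2 with h' | h'
      · exact Or.inr (Or.inr h')
      · exact Or.inr (Or.inl ⟨h.1, h'⟩)
  have hge : ∀ k ∈ insert (i + 1) (Finset.Ico L (t + 1)), i + 1 ≤ k := by
    intro k hk
    rcases hcases k hk with rfl | hk | rfl
    · exact le_rfl
    · exact hiL.le.trans (Finset.mem_Ico.1 hk).1
    · exact hit.le
  refine hbuild _ (i + 1) g (fun k hk => (PNat.lt_add_right i 1).le.trans (hge k hk))
    (fun k hk => ?_) ?_ ?_ ?_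
  · have := PNat.coe_le_coe _ _ |>.2 (hge k hk)
    simpa using this
  · intro a ha b hb hab
    rcases hcases a ha with rfl | ha' | rfl <;> rcases hcases b hb with rfl | hb' | rfl
    · exact le_rfl
    · rw [g1, g3 b hb']
      exact f1 hiG (Finset.mem_insert_of_mem hb')
        ((PNat.lt_add_right i 1).le.trans hab)
    · rw [g1, g2]
      exact (f2 i hiG).le
    · exact absurd (hab.trans_lt hiL) (not_lt.2 (Finset.mem_Ico.1 ha').1)
    · rw [g3 a ha', g3 b hb']
      exact f1 (Finset.mem_insert_of_mem ha') (Finset.mem_insert_of_mem hb') hab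
    · rw [g3 a ha', g2]
      exact (f2 a (Finset.mem_insert_of_mem ha')).le
    · exact absurd hab (not_le.2 hit)
    · exact absurd hab (not_le.2 (Finset.mem_Ico.1 hb').2)
    · exact le_rfl
  · intro k hk
    rcases hcases k hk with rfl | hk' | rfl
    · rw [g1]
      exact (f2 i hiG).trans (Nat.lt_succ_self _)
    · rw [g3 k hk']
      exact (f2 k (Finset.mem_insert_of_mem hk')).trans (Nat.lt_succ_self _)
    · rw [g2]
      exact Nat.lt_succ_self _
  · intro c
    by_cases hc : c = i
    · apply schreier_one_subset hβ γ hγ1 hγ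
      rw [mem_schreier_one]
      intro k _
      have : (insert (i + 1) (Finset.Ico L (t + 1))).filter (fun k => g k = c) ⊆ {t} := by
        intro a ha
        rw [Finset.mem_filter] at ha
        rcases hcases a ha.1 with rfl | ha' | rfl
        · have := f2 i hiG
          rw [g1] at ha
          omega
        · have := f2 a (Finset.mem_insert_of_mem ha')
          rw [g3 a ha'] at ha
          omega
        · simp
      exact (Finset.card_le_card this).trans k.pos
    · have hmem : ∀ a ∈ (insert (i + 1) (Finset.Ico L (t + 1))).filter (fun k => g k = c),
          (a = i + 1 ∧ f i = c) ∨ (a ≠ i + 1 ∧ i + 1 < a ∧ a ∈ Finset.Ico L t ∧ f a = c) := by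
        intro a ha
        rw [Finset.mem_filter] at ha
        rcases hcases a ha.1 with rfl | ha' | rfl
        · exact Or.inl ⟨rfl, g1 ▸ ha.2⟩
        · have h2 := hiL.trans_le (Finset.mem_Ico.1 ha').1
          exact Or.inr ⟨h2.ne', h2, ha', by rw [← g3 a ha']; exact ha.2⟩
        · exact absurd (g2.symm.trans ha.2).symm hc
      refine hregγ _ _ (fun k => if k = i + 1 then i else k) (f3 c) ?_ ?_
      · intro a ha b hb hab
        dsimp only
        rcases hmem a ha with ⟨rfl, -⟩ | ⟨ha1, ha2, -, -⟩ <;>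
          rcases hmem b hb with ⟨rfl, -⟩ | ⟨hb1, hb2, -, -⟩
        · exact absurd hab (lt_irrefl _)
        · rw [if_pos rfl, if_neg hb1]
          exact (PNat.lt_add_right i 1).trans hab
        · exact absurd hab ha2.not_gt
        · rwa [if_neg ha1, if_neg hb1]
      · intro a ha
        rcases hmem a ha with ⟨rfl, h2⟩ | ⟨ha1, ha2, ha3, ha4⟩
        · rw [if_pos rfl]
          exact ⟨(PNat.lt_add_right i 1).le, Finset.mem_filter.2 ⟨hiG, h2⟩⟩
        · rw [if_neg ha1]
          exact ⟨le_rfl, Finset.mem_filter.2 ⟨Finset.mem_insert_of_mem ha3, ha4⟩⟩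

/-! ### The norm on finitely supported vectors -/

theorem bddAbove_values {θ : ℝ} (hθ : θ ∈ Set.Ioc (0 : ℝ) (1 / 2)) (F : Set (Finset ℕ+)) (n : ℕ)
    (x : ℕ+ →₀ ℝ) : BddAbove (values θ F (normSeq θ F n) x) := by
  refine ⟨l1 x, ?_⟩
  rintro _ ⟨d, E, hE, rfl⟩
  exact (isGood_sum hθ (isGood_normSeq hθ F n) hE.1).le_l1 x

theorem monotone_normSeq (θ : ℝ) (F : Set (Finset ℕ+)) (x : ℕ+ →₀ ℝ) :
    Monotone fun n => normSeq θ F n x :=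
  monotone_nat_of_le_succ fun _ => le_max_left _ _

theorem bddAbove_normSeq {θ : ℝ} (hθ : θ ∈ Set.Ioc (0 : ℝ) (1 / 2)) (F : Set (Finset ℕ+))
    (x : ℕ+ →₀ ℝ) : BddAbove (Set.range fun n => normSeq θ F n x) :=
  ⟨l1 x, by rintro _ ⟨n, rfl⟩; exact (isGood_normSeq hθ F n).le_l1 x⟩

theorem normSeq_le_tsirelsonNorm {θ : ℝ} (hθ : θ ∈ Set.Ioc (0 : ℝ) (1 / 2))
    (F : Set (Finset ℕ+)) (n : ℕ) (x : ℕ+ →₀ ℝ) : normSeq θ F n x ≤ tsirelsonNorm θ F x :=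
  le_ciSup (bddAbove_normSeq hθ F x) n

theorem sum_proj_le_tsirelsonNorm {θ : ℝ} (hθ : θ ∈ Set.Ioc (0 : ℝ) (1 / 2))
    {F : Set (Finset ℕ+)} {d : ℕ} {E : Fin d → Finset ℕ+} (hE : Admissible F E) (x : ℕ+ →₀ ℝ) :
    θ * ∑ i, tsirelsonNorm θ F (proj (E i) x) ≤ tsirelsonNorm θ F x := by
  have hlim : Filter.Tendsto (fun n => θ * ∑ i, normSeq θ F n (proj (E i) x)) Filter.atTop
      (nhds (θ * ∑ i, tsirelsonNorm θ F (proj (E i) x))) :=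
    (tendsto_finsetSum _ fun i _ => tendsto_atTop_ciSup (monotone_normSeq θ F _)
      (bddAbove_normSeq hθ F _)).const_mul θ
  refine le_of_tendsto' hlim fun n => ?_
  refine le_trans ?_ (normSeq_le_tsirelsonNorm hθ F (n + 1) x)
  exact (le_csSup (bddAbove_values hθ F n x) ⟨d, E, hE, rfl⟩).trans (le_max_right _ _)

/-- Together with `sum_proj_le_tsirelsonNorm` and `abs_le_tsirelsonNorm` this is the implicit
equation of the norm on $c_{00}$. -/
theorem tsirelsonNorm_le {θ : ℝ} (hθ : θ ∈ Set.Ioc (0 : ℝ) (1 / 2)) {F : Set (Finset ℕ+)}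
    {x : ℕ+ →₀ ℝ} {b : ℝ} (h0 : ∀ k, |x k| ≤ b)
    (h1 : ∀ (d : ℕ) (E : Fin d → Finset ℕ+), Admissible F E →
      θ * ∑ i, tsirelsonNorm θ F (proj (E i) x) ≤ b) : tsirelsonNorm θ F x ≤ b := by
  have hb : 0 ≤ b := (abs_nonneg _).trans (h0 1)
  refine ciSup_le fun n => ?_
  induction n with
  | zero => exact ciSup_le h0
  | succ n ih =>
    refine max_le ih (Real.sSup_le ?_ hb)
    rintro _ ⟨d, E, hE, rfl⟩
    refine le_trans (mul_le_mul_of_nonneg_left ?_ hθ.1.le) (h1 d E hE)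
    exact Finset.sum_le_sum fun i _ => normSeq_le_tsirelsonNorm hθ F n _

theorem normSeq_le_of_abs_le {θ : ℝ} (hθ : θ ∈ Set.Ioc (0 : ℝ) (1 / 2)) (F : Set (Finset ℕ+))
    (n : ℕ) {x y : ℕ+ →₀ ℝ} (h : ∀ k, |x k| ≤ |y k|) : normSeq θ F n x ≤ normSeq θ F n y := by
  induction n generalizing x y with
  | zero =>
    exact ciSup_le fun k => (h k).trans (le_ciSup (f := fun k => |y k|)
      ⟨l1 y, by rintro _ ⟨n, rfl⟩; exact abs_le_l1 y n⟩ k)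
  | succ n ih =>
    refine max_le ((ih h).trans (le_max_left _ _)) (Real.sSup_le ?_ ?_)
    · rintro _ ⟨d, E, hE, rfl⟩
      refine le_trans (mul_le_mul_of_nonneg_left ?_ hθ.1.le)
        ((le_csSup (bddAbove_values hθ F n y) ⟨d, E, hE, rfl⟩).trans (le_max_right _ _))
      refine Finset.sum_le_sum fun i _ => ih fun k => ?_
      simp only [proj, Finsupp.filter_apply]
      split_ifs
      · exact h k
      · exact le_rfl
    · exact (isGood_normSeq hθ F (n + 1)).nonneg y

theorem tsirelsonNorm_le_of_abs_le {θ : ℝ} (hθ : θ ∈ Set.Ioc (0 : ℝ) (1 / 2))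
    (F : Set (Finset ℕ+)) {x y : ℕ+ →₀ ℝ} (h : ∀ k, |x k| ≤ |y k|) :
    tsirelsonNorm θ F x ≤ tsirelsonNorm θ F y :=
  ciSup_le fun n => (normSeq_le_of_abs_le hθ F n h).trans (normSeq_le_tsirelsonNorm hθ F n y)

/-! ### Coordinates and coordinate projections -/

section Space

variable (θ : ℝ) (hθ : θ ∈ Set.Ioc (0 : ℝ) (1 / 2)) (F : Set (Finset ℕ+))

/-- The inclusion of `c₀₀` into `T[θ, F]`. -/
noncomputable def embed : (ℕ+ →₀ ℝ) →ₗ[ℝ] Space θ hθ F where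
  toFun x := ((show C00 θ hθ F from x) : UniformSpace.Completion (C00 θ hθ F))
  map_add' x y := UniformSpace.Completion.coe_add (α := C00 θ hθ F) x y
  map_smul' c x := UniformSpace.Completion.coe_smul (X := C00 θ hθ F) c x

/-- The coordinate functionals on `c₀₀`. -/
noncomputable def coordC00 (k : ℕ+) : C00 θ hθ F →L[ℝ] ℝ :=
  LinearMap.mkContinuous (Finsupp.lapply k : (ℕ+ →₀ ℝ) →ₗ[ℝ] ℝ) 1
    fun x => by rw [one_mul]; exact abs_le_tsirelsonNorm hθ F x k

/-- The coordinate functionals on `T[θ, F]`. -/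
noncomputable def coordL (k : ℕ+) : Space θ hθ F →L[ℝ] ℝ :=
  (coordC00 θ hθ F k).extend UniformSpace.Completion.toComplL

variable {θ hθ F}

/-- The `k`-th coordinate of a vector of `T[θ, F]`. -/
noncomputable def coord (k : ℕ+) (x : Space θ hθ F) : ℝ := coordL θ hθ F k x

/-- The projection of a vector of `T[θ, F]` onto the coordinates in `E`. -/
noncomputable def restr (E : Finset ℕ+) (x : Space θ hθ F) : Space θ hθ F :=
  ∑ k ∈ E, coord k x • unitVec θ hθ F k

theorem embed_induction {p : Space θ hθ F → Prop} (hp : IsClosed {x | p x})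
    (h : ∀ x, p (embed θ hθ F x)) (x : Space θ hθ F) : p x :=
  UniformSpace.Completion.induction_on x hp h

theorem norm_embed (x : ℕ+ →₀ ℝ) : ‖embed θ hθ F x‖ = tsirelsonNorm θ F x :=
  UniformSpace.Completion.norm_coe (E := C00 θ hθ F) x

theorem coord_embed (k : ℕ+) (x : ℕ+ →₀ ℝ) : coord k (embed θ hθ F x) = x k :=
  ContinuousLinearMap.extend_eq (coordC00 θ hθ F k)
    UniformSpace.Completion.denseRange_coe (UniformSpace.Completion.isUniformInducing_coe _) x

theorem embed_single (k : ℕ+) (c : ℝ) :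
    embed θ hθ F (Finsupp.single k c) = c • unitVec θ hθ F k := by
  have : Finsupp.single k c = c • Finsupp.single k (1 : ℝ) := by simp
  rw [this, map_smul]
  rfl

theorem continuous_coord (k : ℕ+) : Continuous (coord k : Space θ hθ F → ℝ) :=
  (coordL θ hθ F k).continuous

@[simp] theorem coord_zero (k : ℕ+) : coord k (0 : Space θ hθ F) = 0 := map_zero _
@[simp] theorem coord_add (k : ℕ+) (x y : Space θ hθ F) :
    coord k (x + y) = coord k x + coord k y := map_add _ _ _
@[simp] theorem coord_sub (k : ℕ+) (x y : Space θ hθ F) :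
    coord k (x - y) = coord k x - coord k y := map_sub _ _ _
@[simp] theorem coord_neg (k : ℕ+) (x : Space θ hθ F) : coord k (-x) = -coord k x := map_neg _ _
@[simp] theorem coord_smul (k : ℕ+) (c : ℝ) (x : Space θ hθ F) :
    coord k (c • x) = c * coord k x := map_smul (coordL θ hθ F k) c x
@[simp] theorem coord_sum {ι : Type*} (k : ℕ+) (s : Finset ι) (f : ι → Space θ hθ F) :
    coord k (∑ i ∈ s, f i) = ∑ i ∈ s, coord k (f i) := map_sum (coordL θ hθ F k) f s

theorem coord_unitVec (k j : ℕ+) : coord k (unitVec θ hθ F j) = if k = j then 1 else 0 := by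
  have := coord_embed (θ := θ) (hθ := hθ) (F := F) k (Finsupp.single j 1)
  rw [embed_single, one_smul] at this
  rw [this, Finsupp.single_apply]
  simp only [eq_comm]

@[simp] theorem coord_unitVec_self (k : ℕ+) : coord k (unitVec θ hθ F k) = 1 := by
  simp [coord_unitVec]

theorem abs_coord_le (k : ℕ+) (x : Space θ hθ F) : |coord k x| ≤ ‖x‖ := by
  refine embed_induction (isClosed_le (continuous_coord k).abs continuous_norm) (fun x => ?_) x
  rw [coord_embed, norm_embed]
  exact abs_le_tsirelsonNorm hθ F x k

theorem continuous_restr (E : Finset ℕ+) : Continuous (restr E : Space θ hθ F → _) :=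
  continuous_finsetSum _ fun k _ => (continuous_coord k).smul continuous_const

theorem coord_restr (k : ℕ+) (E : Finset ℕ+) (x : Space θ hθ F) :
    coord k (restr E x) = if k ∈ E then coord k x else 0 := by
  simp [restr, coord_unitVec]

theorem restr_add (E : Finset ℕ+) (x y : Space θ hθ F) :
    restr E (x + y) = restr E x + restr E y := by
  simp [restr, add_smul, Finset.sum_add_distrib]

theorem restr_sub (E : Finset ℕ+) (x y : Space θ hθ F) :
    restr E (x - y) = restr E x - restr E y := by
  simp [restr, sub_smul]

theorem restr_smul (E : Finset ℕ+) (c : ℝ) (x : Space θ hθ F) :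
    restr E (c • x) = c • restr E x := by
  simp [restr, mul_smul, Finset.smul_sum]

theorem restr_unitVec (E : Finset ℕ+) (k : ℕ+) :
    restr E (unitVec θ hθ F k) = if k ∈ E then unitVec θ hθ F k else 0 := by
  simp [restr, coord_unitVec]

theorem restr_congr {E : Finset ℕ+} {x y : Space θ hθ F} (h : ∀ k ∈ E, coord k x = coord k y) :
    restr E x = restr E y :=
  Finset.sum_congr rfl fun k hk => by rw [h k hk]

theorem restr_embed (E : Finset ℕ+) (x : ℕ+ →₀ ℝ) :
    restr E (embed θ hθ F x) = embed θ hθ F (proj E x) := by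
  have : proj E x = ∑ k ∈ E, Finsupp.single k (x k) := by
    ext k
    simp [proj, Finsupp.filter_apply, Finsupp.finsetSum_apply, Finsupp.single_apply]
  rw [this, map_sum]
  simp [restr, coord_embed, embed_single]

theorem restr_eq_embed (E : Finset ℕ+) (x : Space θ hθ F) :
    restr E x = embed θ hθ F (∑ k ∈ E, Finsupp.single k (coord k x)) := by
  rw [map_sum]
  simp [restr, embed_single]

theorem norm_restr_le (E : Finset ℕ+) (x : Space θ hθ F) : ‖restr E x‖ ≤ ‖x‖ := by
  refine embed_induction (isClosed_le (continuous_restr E).norm continuous_norm) (fun x => ?_) x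
  rw [restr_embed, norm_embed, norm_embed]
  refine tsirelsonNorm_le_of_abs_le hθ F fun k => ?_
  rw [proj, Finsupp.filter_apply]
  split_ifs <;> simp

theorem norm_sub_restr_le (E : Finset ℕ+) (x : Space θ hθ F) : ‖x - restr E x‖ ≤ ‖x‖ := by
  refine embed_induction (p := fun x => ‖x - restr E x‖ ≤ ‖x‖)
    (isClosed_le (continuous_id.sub (continuous_restr E)).norm continuous_norm) (fun x => ?_) x
  rw [restr_embed, ← map_sub, norm_embed, norm_embed]
  refine tsirelsonNorm_le_of_abs_le hθ F fun k => ?_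
  rw [Finsupp.sub_apply, proj, Finsupp.filter_apply]
  split_ifs <;> simp

theorem restr_restr (E E' : Finset ℕ+) (x : Space θ hθ F) :
    restr E (restr E' x) = restr (E ∩ E') x := by
  simp only [restr]
  rw [Finset.sum_congr rfl fun k _ => by
    rw [coord_sum]]
  rw [← Finset.filter_mem_eq_inter, Finset.sum_filter]
  refine Finset.sum_congr rfl fun k _ => ?_
  simp [coord_unitVec]

theorem norm_restr_mono {E E' : Finset ℕ+} (h : E ⊆ E') (x : Space θ hθ F) :
    ‖restr E x‖ ≤ ‖restr E' x‖ := by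
  have := norm_restr_le E (restr E' x)
  rwa [restr_restr, Finset.inter_eq_left.2 h] at this

theorem tendsto_restr (x : Space θ hθ F) :
    Filter.Tendsto (fun E => restr E x) Filter.atTop (nhds x) := by
  rw [Metric.tendsto_atTop]
  intro ε hε
  obtain ⟨y, hy⟩ : ∃ y : ℕ+ →₀ ℝ, dist x (embed θ hθ F y) < ε :=
    (UniformSpace.Completion.denseRange_coe (α := C00 θ hθ F)).exists_dist_lt x hε
  refine ⟨y.support, fun E hE => ?_⟩
  have hy2 : restr E (embed θ hθ F y) = embed θ hθ F y := by
    rw [restr_embed]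
    congr 1
    ext k
    rw [proj, Finsupp.filter_apply]
    split_ifs with h
    · rfl
    · exact (Finsupp.notMem_support_iff.1 fun h' => h (hE h')).symm
  have h1 := norm_sub_restr_le E (x - embed θ hθ F y)
  rw [restr_sub, hy2] at h1
  rw [dist_comm, dist_eq_norm]
  rw [dist_eq_norm] at hy
  refine lt_of_le_of_lt (le_trans (le_of_eq ?_) h1) hy
  congr 1
  abel

theorem hasSum_coord (x : Space θ hθ F) : HasSum (fun k => coord k x • unitVec θ hθ F k) x :=
  tendsto_restr x

theorem ext_coord {x y : Space θ hθ F} (h : ∀ k, coord k x = coord k y) : x = y := by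
  have := hasSum_coord x
  simp only [h] at this
  exact this.unique (hasSum_coord y)

theorem coord_eq_of_hasSum {a : ℕ+ → ℝ} {x : Space θ hθ F}
    (h : HasSum (fun i => a i • unitVec θ hθ F i) x) (k : ℕ+) : coord k x = a k := by
  have h1 : HasSum (fun i => coord k (a i • unitVec θ hθ F i)) (coord k x) :=
    h.mapL (coordL θ hθ F k)
  have h2 : HasSum (fun i => coord k (a i • unitVec θ hθ F i)) (a k) := by
    convert hasSum_single k ?_ using 1
    · simp
    · intro i hi
      simp [coord_unitVec, hi.symm]
  exact h1.unique h2

theorem existsUnique_hasSum (x : Space θ hθ F) :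
    ∃! a : ℕ+ → ℝ, HasSum (fun i => a i • unitVec θ hθ F i) x :=
  ⟨fun k => coord k x, hasSum_coord x, fun _ ha => funext fun k => (coord_eq_of_hasSum ha k).symm⟩

theorem norm_le_of_restr {x : Space θ hθ F} {b : ℝ} (h : ∀ E, ‖restr E x‖ ≤ b) : ‖x‖ ≤ b :=
  le_of_tendsto' (tendsto_restr x).norm h

theorem norm_le_of_abs_coord_le {x y : Space θ hθ F} (h : ∀ k, |coord k x| ≤ |coord k y|) :
    ‖x‖ ≤ ‖y‖ := by
  refine norm_le_of_restr fun E => le_trans ?_ (norm_restr_le E y)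
  rw [restr_eq_embed, restr_eq_embed, norm_embed, norm_embed]
  refine tsirelsonNorm_le_of_abs_le hθ F fun k => ?_
  rw [← coord_embed (θ := θ) (hθ := hθ) (F := F), ← coord_embed (θ := θ) (hθ := hθ) (F := F),
    ← restr_eq_embed, ← restr_eq_embed, coord_restr, coord_restr]
  split_ifs
  · exact h k
  · exact le_rfl

/-- Lower semicontinuity of the norm: on each finite set of coordinates the convergence is in norm,
and the norm is recovered from finite restrictions. -/
theorem norm_le_of_tendsto_coord {ι : Type*} {l : Filter ι} [l.NeBot] {x : ι → Space θ hθ F}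
    {z : Space θ hθ F} {b : ℝ}
    (h : ∀ k, Filter.Tendsto (fun i => coord k (x i)) l (nhds (coord k z)))
    (hb : ∀ᶠ i in l, ‖x i‖ ≤ b) : ‖z‖ ≤ b := by
  refine norm_le_of_restr fun E => ?_
  have hlim : Filter.Tendsto (fun i => restr E (x i)) l (nhds (restr E z)) :=
    tendsto_finsetSum _ fun k _ => (h k).smul_const _
  refine le_of_tendsto hlim.norm ?_
  filter_upwards [hb] with i hi
  exact (norm_restr_le E _).trans hi

theorem tendsto_coord_cofinite (x : Space θ hθ F) :
    Filter.Tendsto (fun k => coord k x) Filter.cofinite (nhds 0) := by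
  have h := (hasSum_coord x).summable.tendsto_cofinite_zero
  refine squeeze_zero_norm (fun k => ?_) (tendsto_zero_iff_norm_tendsto_zero.1 h)
  have := abs_coord_le k (coord k x • unitVec θ hθ F k)
  simpa using this

/-! ### The implicit equation for the norm -/

theorem sum_restr_le {d : ℕ} {E : Fin d → Finset ℕ+} (hE : Admissible F E) (x : Space θ hθ F) :
    θ * ∑ i, ‖restr (E i) x‖ ≤ ‖x‖ := by
  refine embed_induction (p := fun x => θ * ∑ i, ‖restr (E i) x‖ ≤ ‖x‖)
    (isClosed_le (continuous_const.mul (continuous_finsetSum _ fun i _ =>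
      (continuous_restr (E i)).norm)) continuous_norm) (fun x => ?_) x
  simp_rw [restr_embed, norm_embed]
  exact sum_proj_le_tsirelsonNorm hθ hE x

theorem norm_le {x : Space θ hθ F} {b : ℝ} (h0 : ∀ k, |coord k x| ≤ b)
    (h1 : ∀ (d : ℕ) (E : Fin d → Finset ℕ+), Admissible F E →
      θ * ∑ i, ‖restr (E i) x‖ ≤ b) : ‖x‖ ≤ b := by
  have hb : 0 ≤ b := (abs_nonneg _).trans (h0 1)
  refine norm_le_of_restr fun A => ?_
  rw [restr_eq_embed, norm_embed]
  refine tsirelsonNorm_le hθ (fun k => ?_) fun d E hE => ?_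
  · rw [← coord_embed (θ := θ) (hθ := hθ) (F := F), ← restr_eq_embed, coord_restr]
    split_ifs
    · exact h0 k
    · simpa using hb
  · refine le_trans (mul_le_mul_of_nonneg_left (Finset.sum_le_sum fun i _ => ?_) hθ.1.le)
      (h1 d E hE)
    rw [← norm_embed (hθ := hθ), ← restr_embed, ← restr_eq_embed, restr_restr]
    exact norm_restr_mono Finset.inter_subset_left x

theorem norm_unitVec (k : ℕ+) : ‖unitVec θ hθ F k‖ = 1 := by
  refine le_antisymm ?_ ?_
  · have := (isGood_tsirelsonNorm hθ F).le_l1 (Finsupp.single k 1)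
    rw [← norm_embed (hθ := hθ), embed_single, one_smul] at this
    refine this.trans ?_
    have hs : (Finsupp.single k (1 : ℝ)).support ⊆ {k} := Finsupp.support_single_subset
    refine (Finset.sum_le_sum_of_subset_of_nonneg hs fun _ _ _ => abs_nonneg _).trans ?_
    simp
  · simpa using abs_coord_le k (unitVec θ hθ F k)

/-- At most one set of a consecutive family contains a given coordinate. -/
theorem sum_ite_mem_le {d : ℕ} {E : Fin d → Finset ℕ+} (hE : Consecutive E) (k : ℕ+) {c : ℝ}
    (hc : 0 ≤ c) : (∑ i, if k ∈ E i then c else 0) ≤ c := by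
  by_cases h : ∃ i, k ∈ E i
  · obtain ⟨i, hi⟩ := h
    rw [Finset.sum_eq_single i]
    · simp [hi]
    · intro j _ hj
      rw [if_neg]
      intro hkj
      rcases lt_or_gt_of_ne hj with h | h
      · exact lt_irrefl _ (hE.before _ _ h k hkj k hi)
      · exact lt_irrefl _ (hE.before _ _ h k hi k hkj)
    · simp
  · push Not at h
    simpa [h] using hc

theorem coord_sum_smul (A : Finset ℕ+) (a : ℕ+ → ℝ) (k : ℕ+) :
    coord k (∑ k ∈ A, a k • unitVec θ hθ F k) = if k ∈ A then a k else 0 := by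
  simp [coord_unitVec]

theorem norm_restr_sum_le (E A : Finset ℕ+) (a : ℕ+ → ℝ) :
    ‖restr E (∑ k ∈ A, a k • unitVec θ hθ F k)‖ ≤ ∑ k ∈ A, if k ∈ E then |a k| else 0 := by
  have : restr E (∑ k ∈ A, a k • unitVec θ hθ F k) =
      ∑ k ∈ A, (if k ∈ E then a k else 0) • unitVec θ hθ F k := by
    refine ext_coord fun k => ?_
    rw [coord_restr, coord_sum_smul, coord_sum_smul]
    split_ifs <;> rfl
  rw [this]
  refine (norm_sum_le _ _).trans (Finset.sum_le_sum fun k _ => ?_)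
  rw [norm_smul, norm_unitVec, mul_one]
  split_ifs <;> simp

theorem norm_sum_smul_le {A : Finset ℕ+} {a : ℕ+ → ℝ} {b : ℝ}
    (hb : 0 ≤ b) (h0 : ∀ k ∈ A, |a k| ≤ b) (h1 : θ * ∑ k ∈ A, |a k| ≤ b) :
    ‖∑ k ∈ A, a k • unitVec θ hθ F k‖ ≤ b := by
  refine norm_le (fun k => ?_) fun d E hE => ?_
  · rw [coord_sum_smul]
    split_ifs with h
    · exact h0 k h
    · simpa using hb
  · refine le_trans (mul_le_mul_of_nonneg_left ?_ hθ.1.le) h1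
    refine (Finset.sum_le_sum fun i _ => norm_restr_sum_le (E i) A a).trans ?_
    rw [Finset.sum_comm]
    exact Finset.sum_le_sum fun k _ => sum_ite_mem_le hE.1 k (abs_nonneg _)

/-- At most one set of an admissible family contains `i`, so the perturbation enters either through
coordinate `i` alone or with the factor $\theta$. -/
theorem norm_add_smul_unitVec_le (y : Space θ hθ F) (c : ℝ) (i : ℕ+) :
    ‖y + c • unitVec θ hθ F i‖ ≤ max |coord i y + c| (θ * |c| + ‖y‖) := by
  have hc : 0 ≤ θ * |c| := mul_nonneg hθ.1.le (abs_nonneg c)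
  refine norm_le (fun k => ?_) fun d E hE => ?_
  · rw [coord_add, coord_smul, coord_unitVec]
    split_ifs with h
    · rw [h, mul_one]
      exact le_max_left _ _
    · rw [mul_zero, add_zero]
      exact le_max_of_le_right ((abs_coord_le k y).trans (by linarith))
  · refine le_max_of_le_right ?_
    have h1 : ∀ j, ‖restr (E j) (y + c • unitVec θ hθ F i)‖ ≤
        (if i ∈ E j then |c| else 0) + ‖restr (E j) y‖ := by
      intro j
      rw [restr_add, restr_smul, restr_unitVec, add_comm]
      refine (norm_add_le _ _).trans (add_le_add_left ?_ _)
      split_ifs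
      · rw [norm_smul, norm_unitVec, mul_one, Real.norm_eq_abs]
      · simp
    calc θ * ∑ j, ‖restr (E j) (y + c • unitVec θ hθ F i)‖
        ≤ θ * (|c| + ∑ j, ‖restr (E j) y‖) := by
          refine mul_le_mul_of_nonneg_left ?_ hθ.1.le
          refine (Finset.sum_le_sum fun j _ => h1 j).trans ?_
          rw [Finset.sum_add_distrib]
          exact add_le_add_left (sum_ite_mem_le hE.1 i (abs_nonneg c)) _
      _ ≤ θ * |c| + ‖y‖ := by
          rw [mul_add]
          exact add_le_add_right (sum_restr_le hE y) _

theorem norm_smul_add_smul_unitVec {i j : ℕ+} (hij : i ≠ j) {s t : ℝ} (hs : |s| = 1)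
    (ht : |t| = 1) : ‖s • unitVec θ hθ F i + t • unitVec θ hθ F j‖ = 1 := by
  refine le_antisymm ?_ ?_
  · have h := norm_sum_smul_le (θ := θ) (hθ := hθ) (F := F) (A := {i, j})
      (a := fun k => if k = i then s else t) zero_le_one ?_ ?_
    · rwa [Finset.sum_pair hij, if_pos rfl, if_neg hij.symm] at h
    · intro k _
      split_ifs <;> simp [hs, ht]
    · rw [Finset.sum_pair hij, if_pos rfl, if_neg hij.symm, hs, ht]
      have := hθ.2
      linarith
  · have := abs_coord_le i (s • unitVec θ hθ F i + t • unitVec θ hθ F j)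
    simpa [coord_unitVec, hij, hs] using this

end Space

/-! ### Tails, bounded completeness and null families -/

section Tails

variable {θ : ℝ} {hθ : θ ∈ Set.Ioc (0 : ℝ) (1 / 2)} {F : Set (Finset ℕ+)}

/-- The projection of a vector of `T[θ, F]` onto the coordinates from `M` on. -/
noncomputable def tail (M : ℕ+) (x : Space θ hθ F) : Space θ hθ F :=
  x - restr (Finset.Ico 1 M) x

theorem coord_tail (k M : ℕ+) (x : Space θ hθ F) :
    coord k (tail M x) = if M ≤ k then coord k x else 0 := by
  rw [tail, coord_sub, coord_restr]
  by_cases h : M ≤ k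
  · simp [h]
  · simp [h, not_le.1 h]

theorem tail_one (x : Space θ hθ F) : tail 1 x = x := by
  refine ext_coord fun k => ?_
  simp [coord_tail]

theorem tail_sub (M : ℕ+) (x y : Space θ hθ F) : tail M (x - y) = tail M x - tail M y := by
  rw [tail, tail, tail, restr_sub]
  abel

theorem norm_tail_le (M : ℕ+) (x : Space θ hθ F) : ‖tail M x‖ ≤ ‖x‖ := norm_sub_restr_le _ _

theorem tail_tail {M M' : ℕ+} (h : M ≤ M') (x : Space θ hθ F) : tail M' (tail M x) = tail M' x := by
  refine ext_coord fun k => ?_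
  rw [coord_tail, coord_tail, coord_tail]
  split_ifs with h1 h2 <;> first | rfl | exact absurd (h.trans h1) h2

theorem norm_tail_anti {M M' : ℕ+} (h : M ≤ M') (x : Space θ hθ F) : ‖tail M' x‖ ≤ ‖tail M x‖ := by
  rw [← tail_tail h x]
  exact norm_tail_le _ _

theorem restr_tail (E : Finset ℕ+) (M : ℕ+) (x : Space θ hθ F) :
    restr E (tail M x) = restr (E.filter (M ≤ ·)) x := by
  refine ext_coord fun k => ?_
  rw [coord_restr, coord_restr, coord_tail]
  by_cases h1 : k ∈ E <;> by_cases h2 : M ≤ k <;> simp [h1, h2]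

theorem exists_norm_tail_lt (x : Space θ hθ F) {ε : ℝ} (hε : 0 < ε) : ∃ M : ℕ+, ‖tail M x‖ < ε := by
  obtain ⟨s, hs⟩ := Metric.tendsto_atTop.1 (tendsto_restr x) ε hε
  obtain ⟨M, hM⟩ := s.exists_le
  refine ⟨M + 1, ?_⟩
  have := hs (Finset.Ico 1 (M + 1)) fun k hk =>
    Finset.mem_Ico.2 ⟨one_le, PNat.lt_add_one_iff.2 (hM k hk)⟩
  rwa [dist_comm, dist_eq_norm] at this

/-- The last set of an admissible family may be replaced by a tail. -/
theorem sum_restr_add_tail_le (hF : Regular F) {d : ℕ} {E : Fin (d + 1) → Finset ℕ+}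
    (hE : Admissible F E) {k M : ℕ+} (hk : k ∈ E (Fin.last d)) (hkM : k ≤ M) (x : Space θ hθ F) :
    θ * (∑ i : Fin d, ‖restr (E i.castSucc) x‖ + ‖tail M x‖) ≤ ‖x‖ := by
  obtain ⟨hcon, hmin⟩ := hE
  have key : ∀ A : Finset ℕ+,
      θ * (∑ i : Fin d, ‖restr (E i.castSucc) x‖ + ‖restr A (tail M x)‖) ≤ ‖x‖ := by
    intro A
    -- Including `M` fixes the minimum of the new last set, so the new set of minima is a spread of
    -- the old one.
    let B := insert M (A.filter (M ≤ ·))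
    have hB : ∀ b ∈ B, M ≤ b := by
      intro b hb
      rcases Finset.mem_insert.1 hb with rfl | hb
      · exact le_rfl
      · exact (Finset.mem_filter.1 hb).2
    let E' : Fin (d + 1) → Finset ℕ+ := Function.update E (Fin.last d) B
    have hlast : E' (Fin.last d) = B := Function.update_self _ _ _
    have hother : ∀ i, i ≠ Fin.last d → E' i = E i := fun i hi => Function.update_of_ne hi _ _
    have hbelow : ∀ i, i ≠ Fin.last d → ∀ a ∈ E i, a < M := fun i hi a ha =>
      (hcon.before i _ (Fin.lt_last_iff_ne_last.2 hi) a ha k hk).trans_le hkM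
    have hcon' : Consecutive E' := by
      refine ⟨fun i => ?_, fun i j hij => ?_⟩
      · by_cases hi : i = Fin.last d
        · rw [hi, hlast]
          exact ⟨M, Finset.mem_insert_self _ _⟩
        · rw [hother i hi]
          exact hcon.nonempty i
      · have hi : i ≠ Fin.last d := (hij.trans_le (Fin.le_last j)).ne
        rw [hother i hi]
        by_cases hj : j = Fin.last d
        · rw [hj, hlast]
          exact fun a ha b hb => (hbelow i hi a ha).trans_le (hB b hb)
        · rw [hother j hj]
          exact hcon.before i j hij
    have hminlast : (E' (Fin.last d)).min' (hcon'.nonempty _) = M := by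
      refine le_antisymm (Finset.min'_le _ _ ?_) (Finset.le_min' _ _ _ ?_)
      · rw [hlast]
        exact Finset.mem_insert_self _ _
      · rw [hlast]
        exact hB
    have hminother : ∀ i, i ≠ Fin.last d →
        (E' i).min' (hcon'.nonempty _) = (E i).min' (hcon.nonempty _) := by
      intro i hi
      congr 1
      exact hother i hi
    set m := (E (Fin.last d)).min' (hcon.nonempty _) with hm
    have hmM : m ≤ M := (Finset.min'_le _ _ hk).trans hkM
    have hmins : ∀ a ∈ Finset.univ.image (fun i => (E' i).min' (hcon'.nonempty i)),
        a = M ∨ (a < M ∧ a < m ∧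
          a ∈ Finset.univ.image (fun i => (E i).min' (hcon.nonempty i))) := by
      intro a ha
      obtain ⟨i, -, rfl⟩ := Finset.mem_image.1 ha
      by_cases hi : i = Fin.last d
      · left
        subst hi
        exact hminlast
      · right
        rw [hminother i hi]
        refine ⟨hbelow i hi _ (Finset.min'_mem _ _), ?_,
          Finset.mem_image.2 ⟨i, Finset.mem_univ _, rfl⟩⟩
        exact hcon.before i _ (Fin.lt_last_iff_ne_last.2 hi) _ (Finset.min'_mem _ _) _
          (Finset.min'_mem _ _)
    have hadm : Admissible F E' := by
      refine ⟨hcon', hF _ _ (fun a => if a = M then m else a) hmin ?_ ?_⟩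
      · intro a ha b hb hab
        dsimp only
        rcases hmins a ha with rfl | ⟨ha1, ha2, -⟩ <;>
          rcases hmins b hb with hb | ⟨hb1, hb2, -⟩
        · exact absurd (hab.trans_eq hb) (lt_irrefl _)
        · exact absurd (hab.trans hb1) (lt_irrefl _)
        · rw [if_neg ha1.ne, if_pos hb]
          exact ha2
        · rwa [if_neg ha1.ne, if_neg hb1.ne]
      · intro a ha
        rcases hmins a ha with rfl | ⟨ha1, ha2, ha3⟩
        · rw [if_pos rfl]
          exact ⟨hmM, Finset.mem_image.2 ⟨Fin.last d, Finset.mem_univ _, rfl⟩⟩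
        · rw [if_neg ha1.ne]
          exact ⟨le_rfl, ha3⟩
    have h := sum_restr_le hadm x
    rw [Fin.sum_univ_castSucc, hlast] at h
    simp only [hother _ (Fin.castSucc_lt_last _).ne] at h
    refine le_trans (mul_le_mul_of_nonneg_left (add_le_add_right ?_ _) hθ.1.le) h
    rw [restr_tail]
    exact norm_restr_mono (Finset.subset_insert _ _) x
  exact le_of_tendsto' (((tendsto_restr (tail M x)).norm.const_add _).const_mul θ) key

/-- The unit vectors form a boundedly complete basis. -/
theorem summable_of_bounded (hS : ∀ G : Finset ℕ+, (∀ k ∈ G, G.card ≤ (k : ℕ)) → G ∈ F)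
    {w : ℕ+ → ℝ} {C : ℝ} (hw : ∀ A : Finset ℕ+, ‖∑ k ∈ A, w k • unitVec θ hθ F k‖ ≤ C) :
    Summable fun k => w k • unitVec θ hθ F k := by
  rw [summable_iff_vanishing_norm]
  by_contra hcon
  push Not at hcon
  obtain ⟨ε, hε, hcon⟩ := hcon
  choose g hg1 hg2 using fun M : ℕ+ => hcon (Finset.Ico 1 M)
  have hgM : ∀ M, ∀ k ∈ g M, M ≤ k := by
    intro M k hk
    by_contra h
    exact Finset.disjoint_left.1 (hg1 M) hk (Finset.mem_Ico.2 ⟨one_le, not_le.1 h⟩)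
  have hgne : ∀ M, (g M).Nonempty := by
    intro M
    rw [Finset.nonempty_iff_ne_empty]
    intro h
    have := hg2 M
    rw [h, Finset.sum_empty, norm_zero] at this
    exact absurd this (not_le.2 hε)
  -- Beyond `R`, any `R` successive blocks are $\mathcal S_1$-admissible. If each has norm at least
  -- `ε`, the sum has norm at least `θ * (R * ε)`, which exceeds `C`.
  obtain ⟨R, hR⟩ := exists_nat_gt (C / (θ * ε))
  have hRC : C < θ * (R * ε) := by
    rw [div_lt_iff₀ (mul_pos hθ.1 hε)] at hR
    linarith
  let next : ℕ+ → ℕ+ := fun M => (g M).max' (hgne M) + 1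
  have hnext : ∀ M, ∀ k ∈ g M, k < next M := fun M k hk =>
    PNat.lt_add_one_iff.2 (Finset.le_max' _ _ hk)
  let s : ℕ → ℕ+ := fun r => next^[r] R.succPNat
  have hs_succ : ∀ r, s (r + 1) = next (s r) := fun r => Function.iterate_succ_apply' _ _ _
  have hs_mono : Monotone s := monotone_nat_of_le_succ fun r => by
    rw [hs_succ]
    obtain ⟨k, hk⟩ := hgne (s r)
    exact (hgM _ k hk).trans (hnext _ k hk).le
  let E : Fin R → Finset ℕ+ := fun i => g (s i)
  have hE : Consecutive E := by
    refine ⟨fun i => hgne _, fun i j hij a ha b hb => ?_⟩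
    have h1 := hnext _ a ha
    rw [← hs_succ] at h1
    exact (h1.trans_le (hs_mono hij)).trans_le (hgM _ b hb)
  have hadm : Admissible F E := by
    refine ⟨hE, hS _ fun k hk => ?_⟩
    obtain ⟨i, -, rfl⟩ := Finset.mem_image.1 hk
    refine Finset.card_image_le.trans ?_
    rw [Finset.card_univ, Fintype.card_fin]
    have h1 : R.succPNat ≤ (E i).min' (hE.nonempty i) :=
      (hs_mono (Nat.zero_le i)).trans (hgM _ _ (Finset.min'_mem _ _))
    have h2 := PNat.coe_le_coe _ _ |>.2 h1
    rw [Nat.succPNat_coe] at h2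
    omega
  let A := Finset.univ.biUnion E
  have h1 := (sum_restr_le hadm (∑ k ∈ A, w k • unitVec θ hθ F k)).trans (hw A)
  have h2 : ∀ i, ε ≤ ‖restr (E i) (∑ k ∈ A, w k • unitVec θ hθ F k)‖ := by
    intro i
    refine (hg2 (s i)).trans (le_of_eq ?_)
    congr 1
    refine Finset.sum_congr rfl fun k hk => ?_
    rw [coord_sum_smul, if_pos]
    exact Finset.mem_biUnion.2 ⟨i, Finset.mem_univ _, hk⟩
  have h3 : (R : ℝ) * ε ≤ ∑ i, ‖restr (E i) (∑ k ∈ A, w k • unitVec θ hθ F k)‖ := by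
    have := Finset.sum_le_sum fun i (_ : i ∈ Finset.univ) => h2 i
    simpa using this
  have := mul_le_mul_of_nonneg_left h3 hθ.1.le
  linarith

theorem tendsto_restr_zero {ι : Type*} {l : Filter ι} {u : ι → Space θ hθ F}
    (hu : ∀ k, Filter.Tendsto (fun i => coord k (u i)) l (nhds 0)) (E : Finset ℕ+) :
    Filter.Tendsto (fun i => ‖restr E (u i)‖) l (nhds 0) := by
  have : Filter.Tendsto (fun i => restr E (u i)) l
      (nhds (∑ k ∈ E, (0 : ℝ) • unitVec θ hθ F k)) :=
    tendsto_finsetSum _ fun k _ => (hu k).smul_const _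
  simpa using this.norm

theorem exists_abs_coord_le {p : Space θ hθ F} (hp : ∀ k, |coord k p| < 1) :
    ∃ b < 1, ∀ k, |coord k p| ≤ b := by
  have h := (tendsto_coord_cofinite p).abs.eventually_lt_const
    (show |(0 : ℝ)| < 1 / 2 by norm_num)
  have hfin : {k | ¬ |coord k p| < 1 / 2}.Finite := h
  obtain ⟨k₀, -, hk₀⟩ := (insert 1 hfin.toFinset).exists_max_image (fun k => |coord k p|)
    ⟨1, Finset.mem_insert_self _ _⟩
  refine ⟨max (1 / 2) |coord k₀ p|, max_lt (by norm_num) (hp k₀), fun k => ?_⟩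
  by_cases hk : |coord k p| < 1 / 2
  · exact le_max_of_le_left hk.le
  · exact le_max_of_le_right (hk₀ k (Finset.mem_insert_of_mem (hfin.mem_toFinset.2 hk)))

/-- A unit vector all of whose coordinates are smaller than `1` in modulus is asymptotically at
distance more than `1` from every normalized coordinatewise null sequence. -/
theorem exists_gt_one_eventually_le (hF : Regular F) {ι : Type*} {l : Filter ι}
    {u : ι → Space θ hθ F} (hu1 : ∀ i, ‖u i‖ = 1)
    (hu : ∀ k, Filter.Tendsto (fun i => coord k (u i)) l (nhds 0))
    {p : Space θ hθ F} (hp : ‖p‖ = 1) (hp1 : ∀ k, |coord k p| < 1) :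
    ∃ c > 1, ∀ᶠ i in l, c ≤ ‖p - u i‖ := by
  classical
  have hθ0 := hθ.1
  have hθ2 := hθ.2
  -- `M` is the last index whose tail still has norm one; the defect `η` of the next tail is the
  -- source of the gain.
  obtain ⟨M, hM1, hM2⟩ : ∃ M : ℕ+, ‖tail M p‖ = 1 ∧ ‖tail (M + 1) p‖ < 1 := by
    have hex := exists_norm_tail_lt p one_pos
    have h1 : 1 < PNat.find hex := by
      rw [PNat.lt_find_iff]
      intro m hm
      rw [le_antisymm hm one_le, tail_one, hp]
      exact lt_irrefl _
    obtain ⟨M, hM⟩ : ∃ M, PNat.find hex = M + 1 := ⟨_, (PNat.sub_add_of_lt h1).symm⟩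
    refine ⟨M, le_antisymm ((norm_tail_le M p).trans hp.le) ?_, hM ▸ PNat.find_spec hex⟩
    exact not_lt.1 (PNat.find_min hex (hM ▸ PNat.lt_add_right M 1))
  set v := tail M p with hv
  set η := 1 - ‖tail (M + 1) p‖ with hη
  have hη0 : 0 < η := by linarith
  have hη1 : η ≤ 1 := by linarith [norm_nonneg (tail (M + 1) p)]
  -- Replacing the last set gains `θ * η = 4 * ε`; the approximation errors consume at most `2 * ε`
  -- of it.
  set ε := θ * η / 4 with hε
  have hε0 : 0 < ε := by positivity
  have hθη : θ * η ≤ 1 / 2 := by nlinarith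
  obtain ⟨b, hb1, hb⟩ := exists_abs_coord_le hp1
  obtain ⟨d, E, hE, hsum⟩ : ∃ (d : ℕ) (E : Fin d → Finset ℕ+), Admissible F E ∧
      1 - ε < θ * ∑ i, ‖restr (E i) v‖ := by
    by_contra hcon
    push Not at hcon
    have hb0 : 0 ≤ b := (abs_nonneg _).trans (hb 1)
    have : ‖v‖ ≤ max b (1 - ε) := by
      refine norm_le (fun k => ?_) fun d E hE => (hcon d E hE).trans (le_max_right _ _)
      rw [hv, coord_tail]
      split_ifs
      · exact (hb k).trans (le_max_left _ _)
      · rw [abs_zero]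
        exact le_max_of_le_left hb0
    rw [hM1] at this
    exact absurd this (not_le.2 (max_lt hb1 (by linarith)))
  obtain _ | d := d
  · simp only [Finset.univ_eq_empty, Finset.sum_empty, mul_zero] at hsum
    linarith
  -- Otherwise all earlier sets miss the support of `v`, and the sum is at most $\theta\le\frac12$,
  -- too small to be nearly norming.
  have hlast : ∀ k ∈ E (Fin.last d), M + 1 ≤ k := by
    intro k hk
    by_contra hkM
    have hkM : k ≤ M := PNat.lt_add_one_iff.1 (not_le.1 hkM)
    have hzero : ∀ i : Fin d, restr (E i.castSucc) v = 0 := by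
      intro i
      rw [hv, restr_tail, Finset.filter_false_of_mem]
      · simp [restr]
      · intro a ha
        exact not_le.2 ((hE.1.before _ _ (Fin.castSucc_lt_last i) a ha k hk).trans_le hkM)
    rw [Fin.sum_univ_castSucc] at hsum
    simp only [hzero, norm_zero, Finset.sum_const_zero, zero_add] at hsum
    have h1 : ‖restr (E (Fin.last d)) v‖ ≤ 1 := (norm_restr_le _ _).trans hM1.le
    nlinarith
  have hlast' : ‖restr (E (Fin.last d)) v‖ ≤ 1 - η := by
    have : restr (E (Fin.last d)) v = restr (E (Fin.last d)) (tail (M + 1) p) := by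
      refine restr_congr fun k hk => ?_
      rw [hv, coord_tail, coord_tail, if_pos (hlast k hk),
        if_pos ((PNat.lt_add_right M 1).le.trans (hlast k hk))]
    rw [this]
    refine (norm_restr_le _ _).trans ?_
    linarith
  rw [Fin.sum_univ_castSucc] at hsum
  obtain ⟨k₀, hk₀⟩ := hE.1.nonempty (Fin.last d)
  obtain ⟨K₁, hK₁⟩ := exists_norm_tail_lt p hε0
  set K := max k₀ K₁ with hK
  have htail : ‖tail K p‖ < ε := (norm_tail_anti (le_max_right _ _) p).trans_lt hK₁
  have hlim : Filter.Tendsto (fun i => ∑ j : Fin d, ‖restr (E j.castSucc) (u i)‖ +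
      ‖restr (Finset.Ico 1 K) (u i)‖) l (nhds 0) := by
    have := (tendsto_finsetSum Finset.univ fun (j : Fin d) _ =>
      tendsto_restr_zero hu (E j.castSucc)).add (tendsto_restr_zero hu (Finset.Ico 1 K))
    simpa using this
  refine ⟨1 + ε, by linarith, ?_⟩
  filter_upwards [hlim.eventually_lt_const hε0] with i hi
  refine le_trans ?_ (sum_restr_add_tail_le hF hE hk₀ (le_max_left k₀ K₁) (p - u i))
  have h1 : ∀ j : Fin d, ‖restr (E j.castSucc) v‖ - ‖restr (E j.castSucc) (u i)‖ ≤
      ‖restr (E j.castSucc) (p - u i)‖ := by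
    intro j
    rw [restr_sub]
    refine le_trans (sub_le_sub_right ?_ _) (norm_sub_norm_le _ _)
    rw [hv, restr_tail]
    exact norm_restr_mono (Finset.filter_subset _ _) p
  have h2 : 1 - ‖restr (Finset.Ico 1 K) (u i)‖ - ε ≤ ‖tail K (p - u i)‖ := by
    rw [tail_sub, norm_sub_rev]
    have h3 := norm_sub_norm_le (tail K (u i)) (tail K p)
    have h4 : ‖u i‖ - ‖restr (Finset.Ico 1 K) (u i)‖ ≤ ‖tail K (u i)‖ := norm_sub_norm_le _ _
    rw [hu1] at h4
    linarith
  have h3 := Finset.sum_le_sum fun j (_ : j ∈ Finset.univ) => h1 j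
  rw [Finset.sum_sub_distrib] at h3
  have h4 : (∑ j : Fin d, ‖restr (E j.castSucc) v‖) + 1 - 2 * ε ≤
      ∑ j : Fin d, ‖restr (E j.castSucc) (p - u i)‖ + ‖tail K (p - u i)‖ := by linarith
  refine le_trans ?_ (mul_le_mul_of_nonneg_left h4 hθ0.le)
  have h5 : θ * ‖restr (E (Fin.last d)) v‖ ≤ θ * (1 - η) :=
    mul_le_mul_of_nonneg_left hlast' hθ0.le
  have h6 : θ * ε ≤ 1 / 2 * ε := mul_le_mul_of_nonneg_right hθ2 hε0.le
  have h7 : θ * η = 4 * ε := by rw [hε]; ring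
  nlinarith

end Tails

/-! ### Centres of symmetry of bounded metric spaces -/

/-- Väisälä's reflection argument for Mazur–Ulam: composing `g`, `ρ`, `g.symm`, `ρ` gives an
isometry that moves `c` twice as far as `g` does, so the bounded supremum of displacements of `c` is
at most half of itself. -/
theorem fixed_of_reflection {Y : Type*} [MetricSpace Y] {c : Y} (ρ : Y ≃ᵢ Y)
    (hρ : ∀ y, dist (ρ y) y = 2 * dist y c) {C : ℝ} (hC : ∀ y, dist y c ≤ C) (g : Y ≃ᵢ Y) :
    g c = c := by
  have hρc : ρ c = c := by
    have := hρ c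
    rwa [dist_self, mul_zero, dist_eq_zero] at this
  have hbdd : BddAbove (Set.range fun g : Y ≃ᵢ Y => dist (g c) c) :=
    ⟨C, by rintro _ ⟨g, rfl⟩; exact hC _⟩
  have key : ∀ g : Y ≃ᵢ Y, 2 * dist (g c) c ≤ ⨆ g : Y ≃ᵢ Y, dist (g c) c := by
    intro g
    refine le_trans (le_of_eq ?_) (le_ciSup hbdd (((g.trans ρ).trans g.symm).trans ρ))
    change 2 * dist (g c) c = dist (ρ (g.symm (ρ (g c)))) c
    calc 2 * dist (g c) c = dist (ρ (g c)) (g c) := (hρ _).symm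
      _ = dist (g (g.symm (ρ (g c)))) (g c) := by rw [g.apply_symm_apply]
      _ = dist (ρ (g.symm (ρ (g c)))) (ρ c) := by rw [g.dist_eq, ρ.dist_eq]
      _ = dist (ρ (g.symm (ρ (g c)))) c := by rw [hρc]
  have h2 : (⨆ g : Y ≃ᵢ Y, dist (g c) c) ≤ (⨆ g : Y ≃ᵢ Y, dist (g c) c) / 2 :=
    ciSup_le fun g => by linarith [key g]
  have h3 := le_ciSup hbdd g
  have h4 : 0 ≤ dist (g c) c := dist_nonneg
  exact dist_eq_zero.1 (by linarith)

/-- The reflection of `Y'`, conjugated by `h`, must fix `c`; hence `ρ'` fixes `h c`, and its only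
fixed point is `c'`. -/
theorem map_center {Y Y' : Type*} [MetricSpace Y] [MetricSpace Y'] (h : Y ≃ᵢ Y') {c : Y} {c' : Y'}
    (ρ : Y ≃ᵢ Y) (hρ : ∀ y, dist (ρ y) y = 2 * dist y c) {C : ℝ} (hC : ∀ y, dist y c ≤ C)
    (ρ' : Y' ≃ᵢ Y') (hρ' : ∀ y, dist (ρ' y) y = 2 * dist y c') : h c = c' := by
  have h1 := fixed_of_reflection ρ hρ hC ((h.trans ρ').trans h.symm)
  change h.symm (ρ' (h c)) = c at h1
  have h2 : ρ' (h c) = h c := by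
    conv_rhs => rw [← h1, h.apply_symm_apply]
  have h3 := hρ' (h c)
  rw [h2, dist_self] at h3
  exact dist_eq_zero.1 (by linarith)

/-! ### Isometries of the unit sphere -/

section Sphere

variable {θ : ℝ} {hθ : θ ∈ Set.Ioc (0 : ℝ) (1 / 2)} {F : Set (Finset ℕ+)}

variable (θ hθ F) in
/-- The unit sphere of `T[θ, F]`. -/
abbrev Sphere : Type := Metric.sphere (0 : Space θ hθ F) 1

theorem norm_coe_sphere (x : Sphere θ hθ F) : ‖(x : Space θ hθ F)‖ = 1 :=
  mem_sphere_zero_iff_norm.1 x.2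

/-- The vector `s • e k`, as a point of the unit sphere. -/
noncomputable def vertex (s : ℝ) (hs : |s| = 1) (k : ℕ+) : Sphere θ hθ F :=
  ⟨s • unitVec θ hθ F k, by
    rw [mem_sphere_zero_iff_norm, norm_smul, norm_unitVec, Real.norm_eq_abs, hs, one_mul]⟩

theorem coe_vertex (s : ℝ) (hs : |s| = 1) (k : ℕ+) :
    ((vertex s hs k : Sphere θ hθ F) : Space θ hθ F) = s • unitVec θ hθ F k := rfl

theorem abs_coord_sphere_le (k : ℕ+) (x : Sphere θ hθ F) : |coord k (x : Space θ hθ F)| ≤ 1 :=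
  (abs_coord_le k _).trans (norm_coe_sphere x).le

theorem norm_map_sub (U : Sphere θ hθ F ≃ᵢ Sphere θ hθ F) (x y : Sphere θ hθ F) :
    ‖(U x : Space θ hθ F) - U y‖ = ‖(x : Space θ hθ F) - y‖ := by
  have := U.dist_eq x y
  rwa [Subtype.dist_eq, Subtype.dist_eq, dist_eq_norm, dist_eq_norm] at this

theorem abs_neg_eq_one {s : ℝ} (hs : |s| = 1) : |-s| = 1 := by rwa [abs_neg]

theorem norm_sub_eq_two {x y : Sphere θ hθ F} {j : ℕ+} {s : ℝ} (hs : |s| = 1)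
    (hx : coord j (x : Space θ hθ F) = s) (hy : coord j (y : Space θ hθ F) = -s) :
    ‖(x : Space θ hθ F) - y‖ = 2 := by
  refine le_antisymm ?_ ?_
  · refine (norm_sub_le _ _).trans ?_
    rw [norm_coe_sphere, norm_coe_sphere]
    norm_num
  · have := abs_coord_le j ((x : Space θ hθ F) - (y : Space θ hθ F))
    rw [coord_sub, hx, hy, sub_neg_eq_add, ← two_mul, abs_mul, hs] at this
    simpa using this

/-- By `norm_add_smul_unitVec_le` the distance is at most $\max(|y_i-s|,1+\theta)$, and $1+\theta<2$
leaves only the coordinate to produce the value $2$. -/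
theorem coord_of_norm_sub_vertex {y : Sphere θ hθ F} {s : ℝ} (hs : |s| = 1) {i : ℕ+}
    (h : ‖(y : Space θ hθ F) - s • unitVec θ hθ F i‖ = 2) :
    coord i (y : Space θ hθ F) = -s := by
  have h1 := norm_add_smul_unitVec_le (y : Space θ hθ F) (-s) i
  rw [neg_smul, ← sub_eq_add_neg, h, abs_neg, hs, norm_coe_sphere, le_max_iff] at h1
  have h2 := hθ.2
  rcases h1 with h1 | h1
  · have h3 := abs_le.1 (abs_coord_sphere_le i y)
    rcases (abs_eq zero_le_one).1 hs with rfl | rfl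
    · rcases le_abs.1 h1 with h4 | h4 <;> linarith
    · rcases le_abs.1 h1 with h4 | h4 <;> linarith
  · linarith

theorem coord_vertex (s : ℝ) (hs : |s| = 1) (i j : ℕ+) :
    coord j ((vertex s hs i : Sphere θ hθ F) : Space θ hθ F) = if j = i then s else 0 := by
  rw [coe_vertex, coord_smul, coord_unitVec]
  split_ifs <;> simp

/-- If the image of `τ • e i` has `j`-th coordinate `σ = ±1`, the isometry maps opposite faces to
opposite faces. -/
theorem coord_map_iff (U : Sphere θ hθ F ≃ᵢ Sphere θ hθ F) {i j : ℕ+} {τ σ : ℝ} (hτ : |τ| = 1)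
    (hσ : |σ| = 1) (h : coord j (U (vertex τ hτ i) : Space θ hθ F) = σ) (y : Sphere θ hθ F) :
    (coord i (y : Space θ hθ F) = -τ ↔ coord j (U y : Space θ hθ F) = -σ) ∧
    (coord i (y : Space θ hθ F) = τ ↔ coord j (U y : Space θ hθ F) = σ) := by
  have hback : ∀ y : Sphere θ hθ F, coord j (U y : Space θ hθ F) = -σ →
      coord i (y : Space θ hθ F) = -τ := by
    intro y hy
    refine coord_of_norm_sub_vertex hτ ?_
    have := norm_sub_eq_two hσ h hy
    rw [norm_map_sub, norm_sub_rev] at this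
    exact this
  -- The point `-z` is at distance two from `z`, so its image lies on the face opposite to `vertex σ
  -- hσ j`. Thus `hback` applies to `-z`, and `z` can play the role of the vertex in the converse
  -- direction.
  set z := U.symm (vertex σ hσ j) with hz
  have hUz : U z = vertex σ hσ j := U.apply_symm_apply _
  have hzi : coord i (z : Space θ hθ F) = τ := by
    have h1 : ‖((-z : Sphere θ hθ F) : Space θ hθ F) - z‖ = 2 := by
      have : ((-z : Sphere θ hθ F) : Space θ hθ F) - z = (-2 : ℝ) • (z : Space θ hθ F) := by
        rw [coe_neg_sphere]
        module
      rw [this, norm_smul, norm_coe_sphere]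
      norm_num
    rw [← norm_map_sub U, hUz] at h1
    have h2 := hback (-z) (coord_of_norm_sub_vertex hσ h1)
    rw [coe_neg_sphere, coord_neg] at h2
    linarith
  have hfwd : ∀ y : Sphere θ hθ F, coord i (y : Space θ hθ F) = -τ →
      coord j (U y : Space θ hθ F) = -σ := by
    intro y hy
    refine coord_of_norm_sub_vertex hσ ?_
    have := norm_sub_eq_two hτ hzi hy
    rw [← norm_map_sub U, norm_sub_rev, hUz] at this
    exact this
  refine ⟨⟨hfwd y, hback y⟩, fun hy => ?_, fun hy => ?_⟩
  · set a := U.symm (vertex (-σ) (abs_neg_eq_one hσ) j) with ha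
    have hUa : U a = vertex (-σ) (abs_neg_eq_one hσ) j := U.apply_symm_apply _
    have hai : coord i (a : Space θ hθ F) = -τ := hback a (by rw [hUa, coord_vertex, if_pos rfl])
    have := norm_sub_eq_two hτ hy hai
    rw [← norm_map_sub U, hUa] at this
    simpa using coord_of_norm_sub_vertex (abs_neg_eq_one hσ) this
  · set a : Sphere θ hθ F := vertex (-τ) (abs_neg_eq_one hτ) i with ha
    have hUa := hfwd a (by rw [ha, coord_vertex, if_pos rfl])
    have := norm_sub_eq_two hσ hy hUa
    rw [norm_map_sub U] at this
    simpa using coord_of_norm_sub_vertex (abs_neg_eq_one hτ) this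

/-- The face of the unit sphere on which the `i`-th coordinate equals `s`. -/
abbrev Face (θ : ℝ) (hθ : θ ∈ Set.Ioc (0 : ℝ) (1 / 2)) (F : Set (Finset ℕ+)) (i : ℕ+) (s : ℝ) :
    Type := {y : Sphere θ hθ F // coord i (y : Space θ hθ F) = s}

theorem norm_reflect {i : ℕ+} {s : ℝ} {y : Space θ hθ F} (hy : coord i y = s) :
    ‖(2 * s) • unitVec θ hθ F i - y‖ = ‖y‖ := by
  have h : ∀ k, |coord k ((2 * s) • unitVec θ hθ F i - y)| = |coord k y| := by
    intro k
    rw [coord_sub, coord_smul, coord_unitVec]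
    split_ifs with hk
    · rw [hk, hy]
      congr 1
      ring
    · rw [mul_zero, zero_sub, abs_neg]
  exact le_antisymm (norm_le_of_abs_coord_le fun k => (h k).le)
    (norm_le_of_abs_coord_le fun k => (h k).ge)

/-- The reflection of a face in its centre. -/
noncomputable def reflectFace (i : ℕ+) (s : ℝ) : Face θ hθ F i s ≃ᵢ Face θ hθ F i s :=
  let f : Face θ hθ F i s → Face θ hθ F i s := fun y =>
    ⟨⟨(2 * s) • unitVec θ hθ F i - (y.1 : Space θ hθ F), by
      rw [mem_sphere_zero_iff_norm, norm_reflect y.2, norm_coe_sphere]⟩, by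
      rw [coord_sub, coord_smul, coord_unitVec_self, y.2]; ring⟩
  IsometryEquiv.mk' f f
    (fun y => Subtype.ext (Subtype.ext (sub_sub_cancel _ _)))
    (Isometry.of_dist_eq fun x y => by
      simp only [Subtype.dist_eq]
      exact dist_sub_left _ _ _)

theorem coe_reflectFace (i : ℕ+) (s : ℝ) (y : Face θ hθ F i s) :
    ((reflectFace i s y).1 : Space θ hθ F) = (2 * s) • unitVec θ hθ F i - (y.1 : Space θ hθ F) :=
  rfl

/-- The centre of a face. -/
noncomputable def faceCenter (i : ℕ+) (s : ℝ) (hs : |s| = 1) : Face θ hθ F i s :=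
  ⟨vertex s hs i, by rw [coord_vertex, if_pos rfl]⟩

theorem dist_reflectFace (i : ℕ+) (s : ℝ) (hs : |s| = 1) (y : Face θ hθ F i s) :
    dist (reflectFace i s y) y = 2 * dist y (faceCenter i s hs) := by
  simp only [Subtype.dist_eq, coe_reflectFace, dist_eq_norm]
  have : (2 * s) • unitVec θ hθ F i - (y.1 : Space θ hθ F) - (y.1 : Space θ hθ F) =
      (-2 : ℝ) • ((y.1 : Space θ hθ F) - s • unitVec θ hθ F i) := by module
  rw [this, norm_smul]
  norm_num
  rfl

/-- `U` restricts to an isometry between the two faces, and the vertices are their centres of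
symmetry. -/
theorem map_vertex (U : Sphere θ hθ F ≃ᵢ Sphere θ hθ F) {i j : ℕ+} {τ σ : ℝ} (hτ : |τ| = 1)
    (hσ : |σ| = 1) (h : coord j (U (vertex τ hτ i) : Space θ hθ F) = σ) :
    U (vertex τ hτ i) = vertex σ hσ j := by
  let g : Face θ hθ F i τ ≃ᵢ Face θ hθ F j σ :=
    ⟨U.toEquiv.subtypeEquiv fun y => (coord_map_iff U hτ hσ h y).2,
      fun x y => U.isometry x.1 y.1⟩
  have hC : ∀ y : Face θ hθ F i τ, dist y (faceCenter i τ hτ) ≤ 2 := by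
    intro y
    simp only [Subtype.dist_eq, dist_eq_norm]
    refine (norm_sub_le _ _).trans ?_
    rw [norm_coe_sphere, norm_coe_sphere]
    norm_num
  have := map_center g (reflectFace i τ) (dist_reflectFace i τ hτ) hC (reflectFace j σ)
    (dist_reflectFace j σ hσ)
  exact congrArg Subtype.val this

theorem norm_vertex_sub_vertex {s t : ℝ} (hs : |s| = 1) (ht : |t| = 1) {i j : ℕ+} (hij : i ≠ j) :
    ‖((vertex s hs i : Sphere θ hθ F) : Space θ hθ F) - (vertex t ht j : Sphere θ hθ F)‖ = 1 := by
  have := norm_smul_add_smul_unitVec (θ := θ) (hθ := hθ) (F := F) hij hs (abs_neg_eq_one ht)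
  rwa [neg_smul, ← sub_eq_add_neg] at this

/-! ### Ultrafilter limits and the images of the unit vectors -/

theorem hyperfilter_eventually_ne (i : ℕ+) :
    ∀ᶠ k in (Filter.hyperfilter ℕ+ : Filter ℕ+), k ≠ i := by
  refine Filter.hyperfilter_le_cofinite ?_
  exact (Set.finite_singleton i).eventually_cofinite_notMem

theorem tendsto_coord_hyperfilter (x : Space θ hθ F) :
    Filter.Tendsto (fun k => coord k x) (Filter.hyperfilter ℕ+ : Filter ℕ+) (nhds 0) :=
  (tendsto_coord_cofinite x).mono_left Filter.hyperfilter_le_cofinite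

/-- A coordinatewise limit of a family of points of the sphere along an ultrafilter. -/
theorem exists_coord_limit (hS : ∀ G : Finset ℕ+, (∀ k ∈ G, G.card ≤ (k : ℕ)) → G ∈ F)
    {ι : Type*} (f : Ultrafilter ι) (x : ι → Sphere θ hθ F) :
    ∃ w : Space θ hθ F, ∀ n, Filter.Tendsto (fun k => coord n (x k : Space θ hθ F)) f
      (nhds (coord n w)) := by
  have hex : ∀ n, ∃ a : ℝ, Filter.Tendsto (fun k => coord n (x k : Space θ hθ F)) f (nhds a) := by
    intro n
    obtain ⟨a, -, ha⟩ := (isCompact_Icc (a := (-1 : ℝ)) (b := 1)).ultrafilter_le_nhds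
      (f.map fun k => coord n (x k : Space θ hθ F)) (by
        rw [Filter.le_principal_iff, Ultrafilter.coe_map, Filter.mem_map]
        exact Filter.univ_mem' fun k => abs_le.1 (abs_coord_sphere_le n (x k)))
    exact ⟨a, ha⟩
  choose a ha using hex
  have hsum : Summable fun k => a k • unitVec θ hθ F k := by
    refine summable_of_bounded hS (C := 1) fun A => ?_
    have hlim : Filter.Tendsto (fun k => restr A (x k : Space θ hθ F)) f
        (nhds (∑ k ∈ A, a k • unitVec θ hθ F k)) :=
      tendsto_finsetSum _ fun k _ => (ha k).smul_const _
    exact le_of_tendsto' hlim.norm fun k => (norm_restr_le _ _).trans (norm_coe_sphere _).le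
  refine ⟨∑' k, a k • unitVec θ hθ F k, fun n => ?_⟩
  rw [coord_eq_of_hasSum hsum.hasSum n]
  exact ha n

/-- A lower estimate of the norm by `N` consecutive coordinates beyond `N` and a tail. -/
theorem sum_add_tail_le (hF : Regular F)
    (hS : ∀ G : Finset ℕ+, (∀ k ∈ G, G.card ≤ (k : ℕ)) → G ∈ F) {n N M : ℕ+} (hn : N < n)
    (hM : n + N ≤ M) (x : Space θ hθ F) :
    θ * (∑ k ∈ Finset.Ico n (n + N), |coord k x| + ‖tail M x‖) ≤ ‖x‖ := by
  let g : ℕ → ℕ+ := fun i => ⟨n + i, Nat.add_pos_left n.pos i⟩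
  have hg : StrictMono g := fun a b hab => by
    rw [← PNat.coe_lt_coe]
    exact Nat.add_lt_add_left hab _
  -- There are `N + 1` singletons with minimum `n ≥ N + 1`, hence an $\mathcal S_1$-admissible
  -- family; the last one is then widened to the tail.
  let E : Fin ((N : ℕ) + 1) → Finset ℕ+ := fun i => {g i}
  have hE : Consecutive E := by
    refine ⟨fun i => Finset.singleton_nonempty _, fun i j hij a ha b hb => ?_⟩
    rw [Finset.mem_singleton.1 ha, Finset.mem_singleton.1 hb]
    exact hg hij
  have hadm : Admissible F E := by
    refine ⟨hE, hS _ fun k hk => ?_⟩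
    obtain ⟨i, -, rfl⟩ := Finset.mem_image.1 hk
    refine Finset.card_image_le.trans ?_
    rw [Finset.card_univ, Fintype.card_fin, Finset.min'_singleton]
    have h1 : (N : ℕ) < n := hn
    have h2 : (g i : ℕ) = n + i := rfl
    omega
  have h := sum_restr_add_tail_le hF hadm (k := g N) (M := M) (Finset.mem_singleton.2 rfl) hM x
  have hsum : ∑ i : Fin N, ‖restr (E i.castSucc) x‖ = ∑ k ∈ Finset.Ico n (n + N), |coord k x| := by
    have h1 : ∀ k, ‖restr {k} x‖ = |coord k x| := by
      intro k
      rw [restr, Finset.sum_singleton, norm_smul, norm_unitVec, mul_one, Real.norm_eq_abs]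
    simp only [E, h1]
    refine Finset.sum_bij (fun i _ => g i) ?_ ?_ ?_ ?_
    · intro i _
      rw [Finset.mem_Ico, ← PNat.coe_le_coe, ← PNat.coe_lt_coe]
      exact ⟨Nat.le_add_right _ _, Nat.add_lt_add_left i.2 _⟩
    · intro i _ j _ hij
      exact Fin.ext (hg.injective hij)
    · intro k hk
      rw [Finset.mem_Ico, ← PNat.coe_le_coe, ← PNat.coe_lt_coe, PNat.add_coe] at hk
      refine ⟨⟨k - n, by omega⟩, Finset.mem_univ _, ?_⟩
      rw [← PNat.coe_inj]
      exact Nat.add_sub_cancel' hk.1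
    · intro i _
      rfl
  rw [hsum] at h
  exact h

/-- The images of the $e_k$, recentred at their coordinatewise limit $w$, form a normalized null
family at mutual distance one, so `exists_gt_one_eventually_le` forces a coordinate of modulus one
in each. Integrality of $\theta^{-1}$ is used to show that $w$ lives on the first $N$ coordinates.
-/
theorem exists_abs_coord_eq_one_hyperfilter (hF : Regular F)
    (hS : ∀ G : Finset ℕ+, (∀ k ∈ G, G.card ≤ (k : ℕ)) → G ∈ F) {N : ℕ+}
    (hN : θ * ((N : ℕ) : ℝ) = 1) (U : Sphere θ hθ F ≃ᵢ Sphere θ hθ F) :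
    ∀ᶠ k in (Filter.hyperfilter ℕ+ : Filter ℕ+), ∃ j : ℕ+,
      |coord j (U (vertex 1 abs_one k) : Space θ hθ F)| = 1 := by
  have hθ0 := hθ.1
  set f := Filter.hyperfilter ℕ+ with hf
  set x : ℕ+ → Sphere θ hθ F := fun k => U (vertex 1 abs_one k) with hx
  obtain ⟨w, hw⟩ := exists_coord_limit hS f x
  have hle : ∀ (s : ℝ) (hs : |s| = 1) (i : ℕ+),
      ‖(U (vertex s hs i) : Space θ hθ F) - w‖ ≤ 1 := by
    intro s hs i
    refine norm_le_of_tendsto_coord (l := (f : Filter ℕ+))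
      (x := fun k => (U (vertex s hs i) : Space θ hθ F) - (x k : Space θ hθ F)) (fun n => ?_) ?_
    · simp only [coord_sub]
      exact (hw n).const_sub _
    · filter_upwards [hyperfilter_eventually_ne i] with k hk
      rw [norm_map_sub, norm_vertex_sub_vertex _ _ hk.symm]
  -- The images of $e_k$ and $-e_k$ are at distance two and each is within one of `w`, so both
  -- distances equal one.
  have hone : ∀ k, ‖(x k : Space θ hθ F) - w‖ = 1 := by
    intro k
    refine le_antisymm (hle 1 abs_one k) ?_
    have h1 := hle (-1) (abs_neg_eq_one abs_one) k
    have h2 : ‖(x k : Space θ hθ F) - U (vertex (-1) (abs_neg_eq_one abs_one) k)‖ = 2 := by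
      rw [norm_map_sub]
      exact norm_sub_eq_two abs_one (by rw [coord_vertex, if_pos rfl])
        (by rw [coord_vertex, if_pos rfl])
    have h3 := norm_sub_le ((x k : Space θ hθ F) - w)
      ((U (vertex (-1) (abs_neg_eq_one abs_one) k) : Space θ hθ F) - w)
    rw [sub_sub_sub_cancel_right, h2] at h3
    linarith
  set u : ℕ+ → Space θ hθ F := fun k => (x k : Space θ hθ F) - w with hu
  have hu0 : ∀ n, Filter.Tendsto (fun k => coord n (u k)) f (nhds 0) := by
    intro n
    have := (hw n).sub_const (coord n w)
    simpa [hu] using this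
  have hcoord : ∀ k, ∃ j, |coord j (u k)| = 1 := by
    intro k
    by_contra hcon
    push Not at hcon
    have hlt : ∀ j, |coord j (u k)| < 1 := fun j =>
      lt_of_le_of_ne ((abs_coord_le j _).trans (hone k).le) (hcon j)
    obtain ⟨c, hc, hev⟩ := exists_gt_one_eventually_le hF (l := (f : Filter ℕ+)) hone hu0
      (hone k) hlt
    obtain ⟨m, hm1, hm2⟩ := (hev.and (hyperfilter_eventually_ne k)).exists
    have h1 : u k - u m = (x k : Space θ hθ F) - x m := sub_sub_sub_cancel_right _ _ _
    have h2 : ‖(x k : Space θ hθ F) - x m‖ = 1 := by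
      rw [norm_map_sub, norm_vertex_sub_vertex _ _ hm2.symm]
    rw [hu] at h1
    simp only [h1] at hm1
    linarith
  have hw0 : ∀ n, N < n → coord n w = 0 := by
    intro n hn
    -- Signs opposite to those of `w` make every $|a_m-w_m|$ equal to $1+|w_m|$.
    set a : ℕ+ → ℝ := fun k => if 0 ≤ coord k w then -1 else 1 with ha
    have haabs : ∀ k, |a k| = 1 := by
      intro k
      simp only [ha]
      split_ifs <;> simp
    have hadist : ∀ k, |a k - coord k w| = 1 + |coord k w| := by
      intro k
      simp only [ha]
      split_ifs with h
      · rw [abs_of_nonneg h, abs_of_neg (by linarith)]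
        ring
      · rw [abs_of_neg (not_le.1 h), abs_of_pos (by linarith [not_le.1 h])]
        ring
    have hcard : (Finset.Ico n (n + N)).card = N := by
      rw [PNat.card_Ico, PNat.add_coe]
      omega
    set q : Space θ hθ F := ∑ k ∈ Finset.Ico n (n + N), a k • unitVec θ hθ F k with hq
    have hqc : ∀ k, coord k q = if k ∈ Finset.Ico n (n + N) then a k else 0 :=
      fun k => coord_sum_smul _ _ k
    have hnmem : n ∈ Finset.Ico n (n + N) :=
      Finset.mem_Ico.2 ⟨le_rfl, PNat.lt_add_right n N⟩
    have hq1 : ‖q‖ = 1 := by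
      refine le_antisymm ?_ ?_
      · refine norm_sum_smul_le zero_le_one (fun k _ => (haabs k).le) ?_
        simp only [haabs, Finset.sum_const, hcard, nsmul_eq_mul, mul_one]
        exact hN.le
      · have := abs_coord_le n q
        rwa [hqc, if_pos hnmem, haabs] at this
    set z := U.symm ⟨q, mem_sphere_zero_iff_norm.2 hq1⟩ with hz
    have hUz : (U z : Space θ hθ F) = q := by rw [hz, U.apply_symm_apply]
    -- The preimage of `q` is almost zero at a late coordinate `k`, so subtracting $e_k$ costs only
    -- $\theta$.
    have hupper : ∀ᶠ k in (f : Filter ℕ+), ‖q - x k‖ ≤ 1 + θ := by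
      have h1 := (tendsto_coord_hyperfilter (z : Space θ hθ F)).eventually_mem
        (Icc_mem_nhds (show -θ < 0 by linarith) hθ0)
      filter_upwards [h1] with k hk
      rw [← hUz, norm_map_sub, coe_vertex, sub_eq_add_neg, ← neg_smul]
      refine (norm_add_smul_unitVec_le _ _ _).trans (max_le ?_ ?_)
      · rw [abs_le]
        constructor <;> linarith [hk.1, hk.2, hθ.2]
      · rw [norm_coe_sphere, abs_neg, abs_one]
        linarith
    -- The lower estimate from `N` coordinates and a tail tends to at least
    -- $\theta(N+\sum|w_m|+1-\delta)=1+\theta+\theta(\sum|w_m|-\delta)$; against `hupper` this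
    -- bounds $\sum|w_m|$ by $\delta$.
    have hsmall : ∀ δ : ℝ, 0 < δ → |coord n w| ≤ δ := by
      intro δ hδ
      obtain ⟨M₁, hM₁⟩ := exists_norm_tail_lt w hδ
      set M := max (n + N) M₁ with hM
      have htail : ‖tail M w‖ < δ := (norm_tail_anti (le_max_right _ _) w).trans_lt hM₁
      have htq : tail M q = 0 := by
        refine ext_coord fun k => ?_
        rw [coord_tail, coord_zero, hqc]
        split_ifs with h1 h2
        · exact absurd ((le_max_left (n + N) M₁).trans h1) (not_le.2 (Finset.mem_Ico.1 h2).2)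
        · rfl
        · rfl
      have hlim : Filter.Tendsto (fun k => θ * (∑ m ∈ Finset.Ico n (n + N),
          |a m - coord m (x k : Space θ hθ F)| + (1 - ‖restr (Finset.Ico 1 M) (u k)‖ - δ))) f
          (nhds (θ * (∑ m ∈ Finset.Ico n (n + N), |a m - coord m w| + (1 - 0 - δ)))) :=
        ((tendsto_finsetSum _ fun m _ => ((hw m).const_sub _).abs).add
          (((tendsto_restr_zero hu0 _).const_sub 1).sub_const δ)).const_mul θ
      have hbound : θ * (∑ m ∈ Finset.Ico n (n + N), |a m - coord m w| + (1 - 0 - δ)) ≤ 1 + θ := by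
        refine le_of_tendsto hlim ?_
        filter_upwards [hupper] with k hk
        refine le_trans ?_ hk
        refine le_trans (mul_le_mul_of_nonneg_left ?_ hθ0.le)
          (sum_add_tail_le hF hS hn (le_max_left (n + N) M₁) _)
        refine add_le_add (le_of_eq (Finset.sum_congr rfl fun m hm => ?_)) ?_
        · rw [coord_sub, hqc, if_pos hm]
        · have h1 : tail M (q - (x k : Space θ hθ F)) =
              -(tail M w) - tail M (u k) := by
            rw [hu, tail_sub, tail_sub, htq]
            abel
          rw [← hM, h1, norm_sub_rev]
          have h2 := norm_sub_norm_le (tail M (u k)) (-tail M w)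
          rw [norm_neg] at h2
          have h3 : ‖u k‖ - ‖restr (Finset.Ico 1 M) (u k)‖ ≤ ‖tail M (u k)‖ :=
            norm_sub_norm_le _ _
          have h4 : ‖u k‖ = 1 := hone k
          linarith
      simp only [hadist, Finset.sum_add_distrib, Finset.sum_const, hcard, nsmul_eq_mul,
        mul_one] at hbound
      have h1 : |coord n w| ≤ ∑ m ∈ Finset.Ico n (n + N), |coord m w| :=
        Finset.single_le_sum (f := fun m => |coord m w|) (fun _ _ => abs_nonneg _) hnmem
      have h2 : θ * (∑ m ∈ Finset.Ico n (n + N), |coord m w|) ≤ θ * δ := by nlinarith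
      exact h1.trans (le_of_mul_le_mul_left h2 hθ0)
    exact abs_eq_zero.1 (le_antisymm (le_of_forall_pos_le_add fun δ hδ => by
      simpa using hsmall δ hδ) (abs_nonneg _))
  -- On the first `N` coordinates `w` may be nonzero, so it must be excluded that the coordinate of
  -- modulus one is among them.
  have hev : ∀ᶠ k in (f : Filter ℕ+), ∀ n ∈ Finset.Icc 1 N, |coord n (u k)| < 1 := by
    rw [Filter.eventually_all_finset]
    intro n _
    exact (hu0 n).abs.eventually_lt_const (by simp)
  filter_upwards [hev] with k hk
  obtain ⟨j, hj⟩ := hcoord k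
  have hjN : N < j := by
    by_contra h
    have := hk j (Finset.mem_Icc.2 ⟨one_le, not_lt.1 h⟩)
    linarith
  refine ⟨j, ?_⟩
  rw [hu] at hj
  simpa [hw0 j hjN] using hj

/-- If $U(se_k)$ had no coordinate of modulus one, it would be at distance more than one from most
$e_m$. But for most $m$ the preimage of $e_m$ is some $\pm e_j$ with $j\ne k$, at distance exactly
one from $se_k$. -/
theorem exists_map_vertex_eq (hF : Regular F)
    (hS : ∀ G : Finset ℕ+, (∀ k ∈ G, G.card ≤ (k : ℕ)) → G ∈ F) {N : ℕ+}
    (hN : θ * ((N : ℕ) : ℝ) = 1) (U : Sphere θ hθ F ≃ᵢ Sphere θ hθ F) {s : ℝ} (hs : |s| = 1)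
    (k : ℕ+) : ∃ (j : ℕ+) (σ : ℝ) (hσ : |σ| = 1), U (vertex s hs k) = vertex σ hσ j := by
  suffices h : ∃ j, |coord j (U (vertex s hs k) : Space θ hθ F)| = 1 by
    obtain ⟨j, hj⟩ := h
    exact ⟨j, _, hj, map_vertex U hs hj rfl⟩
  by_contra hcon
  push Not at hcon
  set y := U (vertex s hs k) with hy
  have hlt : ∀ j, |coord j (y : Space θ hθ F)| < 1 := fun j =>
    lt_of_le_of_ne (abs_coord_sphere_le j y) (hcon j)
  obtain ⟨c, hc, hev⟩ := exists_gt_one_eventually_le hF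
    (l := (Filter.hyperfilter ℕ+ : Filter ℕ+))
    (u := fun m => ((vertex 1 abs_one m : Sphere θ hθ F) : Space θ hθ F))
    (fun m => norm_coe_sphere _) (fun n => by
      refine tendsto_nhds_of_eventually_eq ?_
      filter_upwards [hyperfilter_eventually_ne n] with m hm
      rw [coord_vertex, if_neg hm.symm]) (norm_coe_sphere y) hlt
  have hfar : ∀ (t : ℝ) (ht : |t| = 1), ∀ᶠ m in (Filter.hyperfilter ℕ+ : Filter ℕ+),
      U (vertex t ht k) ≠ vertex 1 abs_one m := by
    intro t ht
    have := (tendsto_coord_hyperfilter (U (vertex t ht k) : Space θ hθ F)).eventually_ne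
      (zero_ne_one)
    filter_upwards [this] with m hm h
    rw [h, coord_vertex, if_pos rfl] at hm
    exact hm rfl
  obtain ⟨m, ⟨⟨h1, j, hj⟩, h2⟩, h3⟩ := (((hev.and
    (exists_abs_coord_eq_one_hyperfilter hF hS hN U.symm)).and (hfar 1 abs_one)).and
      (hfar (-1) (abs_neg_eq_one abs_one))).exists
  have h4 := map_vertex U.symm abs_one hj rfl
  have h5 : vertex 1 abs_one m = U (vertex _ hj j) := by rw [← h4, U.apply_symm_apply]
  have hjk : j ≠ k := by
    rintro rfl
    rcases (abs_eq zero_le_one).1 hj with h6 | h6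
    · simp only [h6] at h5
      exact h2 h5.symm
    · simp only [h6] at h5
      exact h3 h5.symm
  rw [h5, hy, norm_map_sub, norm_vertex_sub_vertex _ _ hjk.symm] at h1
  linarith

end Sphere

/-! ### Coordinatewise action, linear extension and indicator norms -/

section Rigidity

variable {θ : ℝ} {hθ : θ ∈ Set.Ioc (0 : ℝ) (1 / 2)} {F : Set (Finset ℕ+)}

theorem mul_coord_map_le (U : Sphere θ hθ F ≃ᵢ Sphere θ hθ F) {i j : ℕ+} {τ σ : ℝ}
    (hτ : |τ| = 1) (hσ : |σ| = 1) (h : coord j (U (vertex τ hτ i) : Space θ hθ F) = σ)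
    (y : Sphere θ hθ F) :
    σ * coord j (U y : Space θ hθ F) ≤ max 0 (τ * coord i (y : Space θ hθ F)) := by
  have hθ0 := hθ.1
  have hθ2 := hθ.2
  have hτ2 : τ * τ = 1 := by rw [← abs_mul_abs_self, hτ, one_mul]
  have hσ2 : σ * σ = 1 := by rw [← abs_mul_abs_self, hσ, one_mul]
  set a := τ * coord i (y : Space θ hθ F) with ha
  set m := max 0 a with hm
  have hm0 : 0 ≤ m := le_max_left _ _
  have ham : a ≤ m := le_max_right _ _
  have habs : |coord i (y : Space θ hθ F) + τ| = 1 + a := by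
    have h1 : |coord i (y : Space θ hθ F) + τ| = |τ * (coord i (y : Space θ hθ F) + τ)| := by
      rw [abs_mul, hτ, one_mul]
    have h2 : |a| ≤ 1 := by
      rw [ha, abs_mul, hτ, one_mul]
      exact abs_coord_sphere_le i y
    rw [h1, mul_add, hτ2, add_comm, abs_of_nonneg]
    linarith [(abs_le.1 h2).1]
  set v : Space θ hθ F := (y : Space θ hθ F) - coord i (y : Space θ hθ F) • unitVec θ hθ F i
    with hv
  have hvi : coord i v = 0 := by simp [hv]
  have hv1 : ‖v‖ ≤ 1 := by
    have := norm_sub_restr_le {i} (y : Space θ hθ F)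
    rwa [restr, Finset.sum_singleton, norm_coe_sphere] at this
  -- The factor `1 - θ` is small enough to keep `z` on the unit sphere, in the opposite face, and
  -- large enough that only `θ • v` remains in `y - z` off coordinate `i`. The distance is thus at
  -- most `1 + m`, while the image of `z` has `j`-th coordinate `-σ`.
  set z : Space θ hθ F := (1 - θ) • v + (-τ) • unitVec θ hθ F i with hz
  have hzi : coord i z = -τ := by simp [hz, hvi]
  have hz1 : ‖z‖ = 1 := by
    refine le_antisymm ?_ ?_
    · refine (norm_add_smul_unitVec_le _ _ _).trans (max_le ?_ ?_)
      · rw [coord_smul, hvi, mul_zero, zero_add, abs_neg, hτ]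
      · rw [norm_smul, abs_neg, hτ, Real.norm_eq_abs, abs_of_nonneg (by linarith)]
        nlinarith
    · have := abs_coord_le i z
      rwa [hzi, abs_neg, hτ] at this
  set zs : Sphere θ hθ F := ⟨z, mem_sphere_zero_iff_norm.2 hz1⟩ with hzs
  have hdist : ‖(y : Space θ hθ F) - z‖ ≤ 1 + m := by
    have h1 : (y : Space θ hθ F) - z =
        θ • v + (coord i (y : Space θ hθ F) + τ) • unitVec θ hθ F i := by
      rw [hz, hv]
      module
    rw [h1]
    refine (norm_add_smul_unitVec_le _ _ _).trans ?_
    rw [coord_smul, hvi, mul_zero, zero_add, habs, norm_smul, Real.norm_eq_abs,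
      abs_of_pos hθ0]
    have h3 : 0 ≤ 1 + a := habs ▸ abs_nonneg _
    refine max_le (by linarith) ?_
    nlinarith
  have hUz : coord j (U zs : Space θ hθ F) = -σ := (coord_map_iff U hτ hσ h zs).1.1 hzi
  have h1 : ‖(U y : Space θ hθ F) - U zs‖ ≤ 1 + m := by
    rw [norm_map_sub]
    exact hdist
  have h2 := (abs_coord_le j ((U y : Space θ hθ F) - (U zs : Space θ hθ F))).trans h1
  rw [coord_sub, hUz, sub_neg_eq_add] at h2
  have h3 : |σ * (coord j (U y : Space θ hθ F) + σ)| ≤ 1 + m := by rwa [abs_mul, hσ, one_mul]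
  rw [mul_add, hσ2] at h3
  linarith [(abs_le.1 h3).2]

/-- The one-sided bound `mul_coord_map_le` is applied to both signs and to both `U` and its inverse;
the sign of $\tau y_i$ decides which of the four bounds close the equality. -/
theorem mul_coord_map_eq (U : Sphere θ hθ F ≃ᵢ Sphere θ hθ F) {i j : ℕ+} {τ σ : ℝ}
    (hτ : |τ| = 1) (hσ : |σ| = 1) (h : U (vertex τ hτ i) = vertex σ hσ j) (y : Sphere θ hθ F) :
    σ * coord j (U y : Space θ hθ F) = τ * coord i (y : Space θ hθ F) := by
  have hτ' := abs_neg_eq_one hτ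
  have hσ' := abs_neg_eq_one hσ
  have h1 : coord j (U (vertex τ hτ i) : Space θ hθ F) = σ := by rw [h, coord_vertex, if_pos rfl]
  have h2 : coord j (U (vertex (-τ) hτ' i) : Space θ hθ F) = -σ :=
    (coord_map_iff U hτ hσ h1 _).1.1 (by rw [coord_vertex, if_pos rfl])
  have h3 : U.symm (vertex σ hσ j) = vertex τ hτ i := by rw [← h, U.symm_apply_apply]
  have h4 : U.symm (vertex (-σ) hσ' j) = vertex (-τ) hτ' i := by
    rw [← map_vertex U hτ' hσ' h2, U.symm_apply_apply]
  have k1 := mul_coord_map_le U hτ hσ h1 y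
  have k2 := mul_coord_map_le U hτ' hσ' h2 y
  have k3 := mul_coord_map_le U.symm hσ hτ (by rw [h3, coord_vertex, if_pos rfl]) (U y)
  have k4 := mul_coord_map_le U.symm hσ' hτ' (by rw [h4, coord_vertex, if_pos rfl]) (U y)
  rw [U.symm_apply_apply] at k3 k4
  rcases le_total 0 (τ * coord i (y : Space θ hθ F)) with h0 | h0
  · rw [max_eq_right h0] at k1
    rw [neg_mul, neg_mul, max_eq_left (by linarith)] at k2
    rw [max_eq_right (by linarith)] at k3
    linarith
  · rw [max_eq_left h0] at k1
    rw [neg_mul, neg_mul, max_eq_right (by linarith)] at k2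
    rw [neg_mul, neg_mul, max_eq_right (by linarith)] at k4
    linarith

theorem exists_perm_coord_map (hF : Regular F)
    (hS : ∀ G : Finset ℕ+, (∀ k ∈ G, G.card ≤ (k : ℕ)) → G ∈ F) {N : ℕ+}
    (hN : θ * ((N : ℕ) : ℝ) = 1) (U : Sphere θ hθ F ≃ᵢ Sphere θ hθ F) :
    ∃ (ε : ℕ+ → ℝ) (π : Equiv.Perm ℕ+), (∀ i, |ε i| = 1) ∧
      ∀ (y : Sphere θ hθ F) (i : ℕ+),
        coord (π i) (U y : Space θ hθ F) = ε i * coord i (y : Space θ hθ F) := by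
  choose p ε hε hp using fun i => exists_map_vertex_eq hF hS hN U abs_one i
  have hcoord : ∀ (y : Sphere θ hθ F) (i : ℕ+),
      coord (p i) (U y : Space θ hθ F) = ε i * coord i (y : Space θ hθ F) := by
    intro y i
    have h1 := mul_coord_map_eq U abs_one (hε i) (hp i) y
    have h2 : ε i * ε i = 1 := by rw [← abs_mul_abs_self, hε, one_mul]
    calc coord (p i) (U y : Space θ hθ F)
        = (ε i * ε i) * coord (p i) (U y : Space θ hθ F) := by rw [h2, one_mul]
      _ = ε i * coord i (y : Space θ hθ F) := by rw [mul_assoc, h1, one_mul]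
  have hinj : Function.Injective p := by
    intro i j hij
    by_contra hne
    have h1 := hcoord (vertex 1 abs_one i) i
    have h2 := hcoord (vertex 1 abs_one i) j
    rw [coord_vertex, if_pos rfl, mul_one] at h1
    rw [coord_vertex, if_neg (Ne.symm hne), mul_zero, ← hij, h1] at h2
    have := hε i
    rw [h2] at this
    simp at this
  have hsurj : Function.Surjective p := by
    intro j
    obtain ⟨i, σ, hσ, hi⟩ := exists_map_vertex_eq hF hS hN U.symm abs_one j
    refine ⟨i, ?_⟩
    have h1 := hcoord (vertex σ hσ i) i
    rw [← hi, U.apply_symm_apply, hi, coord_vertex, coord_vertex, if_pos rfl] at h1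
    by_contra hne
    rw [if_neg hne] at h1
    have h2 : |ε i * σ| = 1 := by rw [abs_mul, hε, hσ, one_mul]
    rw [← h1] at h2
    simp at h2
  exact ⟨ε, Equiv.ofBijective p ⟨hinj, hsurj⟩, hε, hcoord⟩

/-- The coordinate formula is linear, so the positively homogeneous extension of `U` is linear too;
it preserves the norm by construction. -/
theorem exists_linearIsometryEquiv (U : Sphere θ hθ F ≃ᵢ Sphere θ hθ F) {ε : ℕ+ → ℝ}
    {π : Equiv.Perm ℕ+} (hU : ∀ (y : Sphere θ hθ F) (i : ℕ+),
      coord (π i) (U y : Space θ hθ F) = ε i * coord i (y : Space θ hθ F)) :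
    ∃ V : Space θ hθ F ≃ₗᵢ[ℝ] Space θ hθ F, (∀ x : Sphere θ hθ F, V x = (U x : Space θ hθ F)) ∧
      ∀ (x : Space θ hθ F) (i : ℕ+), coord (π i) (V x) = ε i * coord i x := by
  have hext : ∀ {x y : Space θ hθ F}, (∀ i, coord (π i) x = coord (π i) y) → x = y := by
    intro x y h
    refine ext_coord fun k => ?_
    simpa using h (π.symm k)
  have hnormalize : ∀ x : Space θ hθ F, x ≠ 0 →
      ∃ z : Sphere θ hθ F, x = ‖x‖ • (z : Space θ hθ F) := by
    intro x hx
    have hx' : ‖x‖ ≠ 0 := norm_ne_zero_iff.2 hx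
    refine ⟨⟨‖x‖⁻¹ • x, ?_⟩, ?_⟩
    · rw [mem_sphere_zero_iff_norm, norm_smul, norm_inv, norm_norm, inv_mul_cancel₀ hx']
    · rw [smul_smul, mul_inv_cancel₀ hx', one_smul]
  have hex : ∀ x : Space θ hθ F, ∃ y : Space θ hθ F, ‖y‖ = ‖x‖ ∧
      ∀ i, coord (π i) y = ε i * coord i x := by
    intro x
    rcases eq_or_ne x 0 with rfl | hx
    · exact ⟨0, rfl, by simp⟩
    · obtain ⟨z, hz⟩ := hnormalize x hx
      refine ⟨‖x‖ • (U z : Space θ hθ F), ?_, fun i => ?_⟩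
      · rw [norm_smul, norm_coe_sphere, norm_norm, mul_one]
      · conv_rhs => rw [hz]
        rw [coord_smul, coord_smul, hU]
        ring
  choose V hV1 hV2 using hex
  let VL : Space θ hθ F →ₗᵢ[ℝ] Space θ hθ F :=
    { toFun := V
      map_add' := fun x y => hext fun i => by
        rw [coord_add, hV2, hV2, hV2, coord_add, mul_add]
      map_smul' := fun c x => hext fun i => by
        rw [RingHom.id_apply, coord_smul, hV2, hV2, coord_smul]
        ring
      norm_map' := hV1 }
  have hVU : ∀ x : Sphere θ hθ F, V x = (U x : Space θ hθ F) := fun x =>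
    hext fun i => by rw [hV2, hU]
  have hsurj : Function.Surjective VL := by
    intro y
    rcases eq_or_ne y 0 with rfl | hy
    · exact ⟨0, map_zero VL⟩
    · obtain ⟨z, hz⟩ := hnormalize y hy
      refine ⟨‖y‖ • (U.symm z : Space θ hθ F), ?_⟩
      rw [map_smul]
      conv_rhs => rw [hz]
      congr 1
      exact (hVU _).trans (by rw [U.apply_symm_apply])
  exact ⟨LinearIsometryEquiv.ofSurjective VL hsurj, hVU, hV2⟩

/-- Singletons of `A` are admissible and attain $\theta|A|$; the upper bound needs $\theta|A|\ge1$,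
which is where $|A|>N$ enters. -/
theorem norm_indicator_of_mem {N : ℕ+} (hN : θ * ((N : ℕ) : ℝ) = 1) {A : Finset ℕ+}
    (hA : (N : ℕ) < A.card) (h : A ∈ F) :
    ‖∑ k ∈ A, (1 : ℝ) • unitVec θ hθ F k‖ = θ * A.card := by
  have hAN : ((N : ℕ) : ℝ) ≤ A.card := by exact_mod_cast hA.le
  refine le_antisymm ?_ ?_
  · have h1 : 1 ≤ θ * A.card := hN ▸ mul_le_mul_of_nonneg_left hAN hθ.1.le
    refine norm_sum_smul_le (zero_le_one.trans h1) (fun k _ => by simpa using h1) ?_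
    simp
  · let E : Fin A.card → Finset ℕ+ := fun i => {A.orderEmbOfFin rfl i}
    have hE : Consecutive E := by
      refine ⟨fun i => Finset.singleton_nonempty _, fun i j hij a ha b hb => ?_⟩
      rw [Finset.mem_singleton.1 ha, Finset.mem_singleton.1 hb]
      exact (A.orderEmbOfFin rfl).strictMono hij
    have hadm : Admissible F E := by
      refine ⟨hE, ?_⟩
      convert h using 1
      simp only [E, Finset.min'_singleton]
      exact Finset.image_orderEmbOfFin_univ A rfl
    have h1 := sum_restr_le hadm (∑ k ∈ A, (1 : ℝ) • unitVec θ hθ F k)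
    refine le_trans (le_of_eq ?_) h1
    have h2 : ∀ i, ‖restr (E i) (∑ k ∈ A, (1 : ℝ) • unitVec θ hθ F k)‖ = 1 := by
      intro i
      rw [restr, Finset.sum_singleton, coord_sum_smul, if_pos (Finset.orderEmbOfFin_mem A rfl i),
        one_smul, norm_unitVec]
    simp only [h2, Finset.sum_const, Finset.card_univ, Fintype.card_fin, nsmul_eq_mul, mul_one]

/-- Every admissible sum loses at least one unit. A set meeting `A` in $r\ge2$ points contributes at
most $\max(1,\theta r)\le r-1$. If all intersections have at most one point, then some point of `A`
is uncovered, since otherwise `A` would be a spread of a subset of the minima. -/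
theorem norm_indicator_lt_of_notMem (hF : Regular F) {N : ℕ+} (hN : θ * ((N : ℕ) : ℝ) = 1)
    {A : Finset ℕ+} (hA : (N : ℕ) < A.card) (h : A ∉ F) :
    ‖∑ k ∈ A, (1 : ℝ) • unitVec θ hθ F k‖ < θ * A.card := by
  have hθ0 := hθ.1
  have hAN : ((N : ℕ) : ℝ) < A.card := by exact_mod_cast hA
  have h1 : 1 < θ * A.card := hN ▸ mul_lt_mul_of_pos_left hAN hθ0
  set x := ∑ k ∈ A, (1 : ℝ) • unitVec θ hθ F k with hx
  suffices hle : ‖x‖ ≤ max 1 (θ * (A.card - 1)) from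
    hle.trans_lt (max_lt h1 (by nlinarith))
  refine norm_le (fun k => ?_) fun d E hE => ?_
  · rw [hx, coord_sum_smul]
    split_ifs <;> simp
  refine le_max_of_le_right (mul_le_mul_of_nonneg_left ?_ hθ0.le)
  have hrestr : ∀ i, restr (E i) x = ∑ k ∈ E i ∩ A, (1 : ℝ) • unitVec θ hθ F k := by
    intro i
    refine ext_coord fun k => ?_
    rw [coord_restr, hx, coord_sum_smul, coord_sum_smul]
    by_cases h1 : k ∈ E i <;> by_cases h2 : k ∈ A <;> simp [h1, h2]
  have hle : ∀ i, ‖restr (E i) x‖ ≤ (E i ∩ A).card := by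
    intro i
    rw [hrestr]
    refine (norm_sum_le _ _).trans (le_of_eq ?_)
    simp [norm_unitVec]
  have hle2 : ∀ i, 2 ≤ (E i ∩ A).card → ‖restr (E i) x‖ ≤ (E i ∩ A).card - 1 := by
    intro i hi
    have hi' : (2 : ℝ) ≤ (E i ∩ A).card := by exact_mod_cast hi
    rw [hrestr]
    refine norm_sum_smul_le (by linarith) (fun k _ => by rw [abs_one]; linarith) ?_
    simp only [abs_one, Finset.sum_const, nsmul_eq_mul, mul_one]
    nlinarith [hθ.2]
  have hcard : ∑ i, (E i ∩ A).card = (Finset.univ.biUnion fun i => E i ∩ A).card := by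
    rw [Finset.card_biUnion]
    intro i _ j _ hij
    refine Finset.disjoint_left.2 fun a ha hb => ?_
    rw [Finset.mem_inter] at ha hb
    rcases lt_or_gt_of_ne hij with h | h
    · exact lt_irrefl _ (hE.1.before _ _ h a ha.1 a hb.1)
    · exact lt_irrefl _ (hE.1.before _ _ h a hb.1 a ha.1)
  have hsub : (Finset.univ.biUnion fun i => E i ∩ A) ⊆ A := by
    intro a ha
    obtain ⟨i, -, hi⟩ := Finset.mem_biUnion.1 ha
    exact (Finset.mem_inter.1 hi).2
  have hsumle : ∑ i, ((E i ∩ A).card : ℝ) ≤ A.card := by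
    exact_mod_cast hcard.le.trans (Finset.card_le_card hsub)
  by_cases hbig : ∃ i, 2 ≤ (E i ∩ A).card
  · obtain ⟨i, hi⟩ := hbig
    have h2 : ∑ j, ‖restr (E j) x‖ ≤ ∑ j, (((E j ∩ A).card : ℝ) - if j = i then 1 else 0) := by
      refine Finset.sum_le_sum fun j _ => ?_
      split_ifs with hj
      · subst hj
        exact hle2 j hi
      · simpa using hle j
    rw [Finset.sum_sub_distrib, Finset.sum_ite_eq' Finset.univ i, if_pos (Finset.mem_univ i)] at h2
    linarith
  push Not at hbig
  refine (Finset.sum_le_sum fun i _ => hle i).trans ?_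
  have hne : (Finset.univ.biUnion fun i => E i ∩ A) ≠ A := by
    intro heq
    have hcov : ∀ a, ∃ i, a ∈ A → a ∈ E i := by
      intro a
      by_cases ha : a ∈ A
      · have ha' := ha
        rw [← heq] at ha'
        obtain ⟨i, -, hi⟩ := Finset.mem_biUnion.1 ha'
        exact ⟨i, fun _ => (Finset.mem_inter.1 hi).1⟩
      · obtain ⟨b, hb⟩ : A.Nonempty := Finset.card_pos.1 (N.pos.trans hA)
        rw [← heq] at hb
        obtain ⟨i, -, -⟩ := Finset.mem_biUnion.1 hb
        exact ⟨i, fun h => absurd h ha⟩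
    choose c hc using hcov
    refine h (hF A _ (fun a => (E (c a)).min' (hE.1.nonempty _)) hE.2 ?_ fun a ha =>
      ⟨Finset.min'_le _ _ (hc a ha), Finset.mem_image.2 ⟨c a, Finset.mem_univ _, rfl⟩⟩)
    intro a ha b hb hab
    have hcab : c a < c b := by
      rcases lt_trichotomy (c a) (c b) with h | h | h
      · exact h
      · have h2 : (E (c a) ∩ A).card ≤ 1 := Nat.lt_succ_iff.1 (hbig _)
        rw [Finset.card_le_one] at h2
        exact absurd (h2 a (Finset.mem_inter.2 ⟨hc a ha, ha⟩) b
          (Finset.mem_inter.2 ⟨h ▸ hc b hb, hb⟩)) hab.ne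
      · exact absurd (hE.1.before _ _ h b (hc b hb) a (hc a ha)) hab.not_gt
    exact hE.1.before _ _ hcab _ (Finset.min'_mem _ _) _ (Finset.min'_mem _ _)
  have hlt := Finset.card_lt_card (lt_of_le_of_ne hsub hne)
  rw [← hcard] at hlt
  have h3 : ((∑ i, (E i ∩ A).card : ℕ) : ℝ) + 1 ≤ A.card := by exact_mod_cast hlt
  push_cast at h3
  linarith

/-- The isometry carries the indicator of `A`, up to signs, to that of its image, and for large sets
the norm of the indicator detects membership. -/
theorem mem_iff_of_perm (hF : Regular F) {N : ℕ+} (hN : θ * ((N : ℕ) : ℝ) = 1) {ε : ℕ+ → ℝ}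
    (hε : ∀ i, |ε i| = 1) {π : Equiv.Perm ℕ+} (V : Space θ hθ F ≃ₗᵢ[ℝ] Space θ hθ F)
    (hV : ∀ (x : Space θ hθ F) (i : ℕ+), coord (π i) (V x) = ε i * coord i x)
    {A : Finset ℕ+} (hA : (N : ℕ) < A.card) : A.image π ∈ F ↔ A ∈ F := by
  have hcard : (A.image π).card = A.card := Finset.card_image_of_injective A π.injective
  have hnorm : ‖∑ k ∈ A.image π, (1 : ℝ) • unitVec θ hθ F k‖ =
      ‖∑ k ∈ A, (1 : ℝ) • unitVec θ hθ F k‖ := by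
    rw [← V.norm_map (∑ k ∈ A, (1 : ℝ) • unitVec θ hθ F k)]
    have h : ∀ k, |coord k (∑ k ∈ A.image π, (1 : ℝ) • unitVec θ hθ F k)| =
        |coord k (V (∑ k ∈ A, (1 : ℝ) • unitVec θ hθ F k))| := by
      intro k
      obtain ⟨i, rfl⟩ := π.surjective k
      rw [hV, coord_sum_smul, coord_sum_smul, abs_mul, hε, one_mul]
      simp
    exact le_antisymm (norm_le_of_abs_coord_le fun k => (h k).le)
      (norm_le_of_abs_coord_le fun k => (h k).ge)
  constructor
  · intro h
    by_contra h'
    have h1 := norm_indicator_of_mem (hθ := hθ) hN (hcard.symm ▸ hA) h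
    rw [hnorm, hcard] at h1
    exact (norm_indicator_lt_of_notMem (hθ := hθ) hF hN hA h').ne h1
  · intro h
    by_contra h'
    have h1 := norm_indicator_of_mem (hθ := hθ) hN hA h
    rw [← hnorm, ← hcard] at h1
    exact (norm_indicator_lt_of_notMem (hθ := hθ) hF hN (hcard.symm ▸ hA) h').ne h1

end Rigidity

/-! ### Permutations preserving large Schreier sets -/

/-- The interval $[i,2i)$ is an $\mathcal S_1$-set with $i$ elements; its image has as many and
contains $\pi(i)$, which must therefore be at least $i$. -/
theorem perm_le_of_preserves_schreier_one {β : Ordinal.{0} → ℕ+ → Ordinal.{0}} {N : ℕ+}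
    {π : Equiv.Perm ℕ+}
    (hπ : ∀ A : Finset ℕ+, (N : ℕ) < A.card → (A.image π ∈ schreier β 1 ↔ A ∈ schreier β 1))
    {i : ℕ+} (hi : N < i) : i ≤ π i := by
  have hcard : (Finset.Ico i (i + i)).card = i := by
    rw [PNat.card_Ico, PNat.add_coe]
    omega
  have h1 : Finset.Ico i (i + i) ∈ schreier β 1 := by
    rw [mem_schreier_one]
    intro k hk
    rw [hcard]
    exact (Finset.mem_Ico.1 hk).1
  have h2 := (hπ _ (by rw [hcard]; exact hi)).2 h1
  rw [mem_schreier_one] at h2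
  have h3 := h2 (π i) (Finset.mem_image_of_mem _
    (Finset.mem_Ico.2 ⟨le_rfl, PNat.lt_add_right i i⟩))
  rw [Finset.card_image_of_injective _ π.injective, hcard] at h3
  exact h3

theorem perm_eq_of_preserves_schreier_one {β : Ordinal.{0} → ℕ+ → Ordinal.{0}} {N : ℕ+}
    {π : Equiv.Perm ℕ+}
    (hπ : ∀ A : Finset ℕ+, (N : ℕ) < A.card → (A.image π ∈ schreier β 1 ↔ A ∈ schreier β 1))
    {i : ℕ+} (hi : N < i) : π i = i := by
  have h1 := perm_le_of_preserves_schreier_one hπ hi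
  have hsymm : ∀ A : Finset ℕ+, (N : ℕ) < A.card →
      (A.image π.symm ∈ schreier β 1 ↔ A ∈ schreier β 1) := by
    intro A hA
    have := hπ (A.image π.symm) (by rwa [Finset.card_image_of_injective _ π.symm.injective])
    rw [← this, Finset.image_image]
    simp
  have h2 := perm_le_of_preserves_schreier_one hsymm (hi.trans_le h1)
  rw [Equiv.symm_apply_apply] at h2
  exact le_antisymm h2 h1

/-- An order inversion $\pi(i+1)<\pi(i)$ is incompatible with spreading, so $\pi$ is an increasing
bijection. -/
theorem perm_eq_of_preserves_schreier {β : Ordinal.{0} → ℕ+ → Ordinal.{0}} (hβ : IsLadder β)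
    {α : Ordinal.{0}} (h1 : 1 < α) (hα : α < ω₁) {N : ℕ+} {π : Equiv.Perm ℕ+}
    (hπ : ∀ A : Finset ℕ+, (N : ℕ) < A.card → (A.image π ∈ schreier β α ↔ A ∈ schreier β α))
    (i : ℕ+) : π i = i := by
  have hreg := regular_schreier hβ α hα
  have hstep : ∀ i, π i < π (i + 1) := by
    intro i
    by_contra hcon
    have hne : π (i + 1) ≠ π i := fun h => (PNat.lt_add_right i 1).ne' (π.injective h)
    have hlt : π (i + 1) < π i := lt_of_le_of_ne (not_lt.1 hcon) hne
    -- `A` accepts `π i` but not `π (i + 1)`. Pulled back, `B` would accept `i` but not `i + 1`,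
    -- although replacing `i` by `i + 1` is a spread. The bound on `A.card` keeps the sets above the
    -- size at which `hπ` applies.
    obtain ⟨A, hA1, hA2, hA3, hA4⟩ := exists_separating hβ h1 hα N hlt
    have hiA : π i ∉ A := fun h => lt_irrefl _ (hA1 _ h)
    have hi1A : π (i + 1) ∉ A := fun h => lt_irrefl _ (hlt.trans (hA1 _ h))
    set B := A.image π.symm with hB
    have hBA : B.image π = A := by rw [hB, Finset.image_image]; simp
    have hmem : ∀ k, k ∈ B ↔ π k ∈ A := by
      intro k
      rw [← hBA]
      simp
    have hcardB : B.card = A.card := Finset.card_image_of_injective _ π.symm.injective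
    have hins : ∀ k, π k ∉ A → (insert (π k) A ∈ schreier β α ↔ insert k B ∈ schreier β α) := by
      intro k hk
      rw [← hπ (insert k B), Finset.image_insert, hBA]
      rw [Finset.card_insert_of_notMem (by rwa [hmem]), hcardB]
      omega
    refine hA4 ((hins _ hi1A).2 (hreg.replace (PNat.lt_add_right i 1).le ?_ ((hins _ hiA).1 hA3)))
    intro b hb
    rcases lt_trichotomy b i with h | h | h
    · exact Or.inl h
    · exact absurd ((hmem b).1 hb) (h ▸ hiA)
    · rcases eq_or_lt_of_le (PNat.add_one_le_iff.2 h) with h' | h'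
      · exact absurd ((hmem b).1 hb) (h' ▸ hi1A)
      · exact Or.inr h'
  have hmono : StrictMono π := by
    intro a b
    induction b using PNat.recOn with
    | one => intro h; exact absurd h (not_lt.2 one_le)
    | succ b ih =>
      intro h
      rcases eq_or_lt_of_le (PNat.lt_add_one_iff.1 h) with rfl | h
      · exact hstep a
      · exact (ih h).trans (hstep b)
  have hmono' : StrictMono π.symm := by
    intro a b hab
    rw [← hmono.lt_iff_lt]
    simpa using hab
  refine le_antisymm ?_ hmono.le_apply
  have := hmono'.le_apply (x := π i)
  rwa [Equiv.symm_apply_apply] at this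

end Tsirelson

/-! ### The main theorem -/

theorem theoremB (θ : ℝ) (hθ : θ ∈ Set.Ioc (0 : ℝ) (1 / 2)) (N : ℕ) (hN : θ⁻¹ = (N : ℝ))
    (β : Ordinal.{0} → ℕ+ → Ordinal.{0}) (hβ : IsLadder β)
    (α : Ordinal.{0}) (hα1 : 1 ≤ α) (hα : α < ω₁)
    (U : Metric.sphere (0 : Space θ hθ (schreier β α)) 1 →
      Metric.sphere (0 : Space θ hθ (schreier β α)) 1)
    (hU : Isometry U) (hU' : Function.Surjective U) :
    -- every vector has a unique expansion `∑ a_i e_i`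
    (∀ x : Space θ hθ (schreier β α), ∃! a : ℕ+ → ℝ,
      HasSum (fun i => a i • unitVec θ hθ (schreier β α) i) x) ∧
    (α = 1 → ∃ (ε : ℕ+ → ℝ) (π : Equiv.Perm ℕ+), (∀ i, ε i = 1 ∨ ε i = -1) ∧
      (∀ i : ℕ+, N < (i : ℕ) → π i = i) ∧
      ∀ (x : Metric.sphere (0 : Space θ hθ (schreier β α)) 1) (a : ℕ+ → ℝ),
        HasSum (fun i => a i • unitVec θ hθ (schreier β α) i) (x : Space θ hθ (schreier β α)) →
        HasSum (fun i => (ε i * a i) • unitVec θ hθ (schreier β α) (π i))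
          (U x : Space θ hθ (schreier β α))) ∧
    (1 < α → ∃ ε : ℕ+ → ℝ, (∀ i, ε i = 1 ∨ ε i = -1) ∧
      ∀ (x : Metric.sphere (0 : Space θ hθ (schreier β α)) 1) (a : ℕ+ → ℝ),
        HasSum (fun i => a i • unitVec θ hθ (schreier β α) i) (x : Space θ hθ (schreier β α)) →
        HasSum (fun i => (ε i * a i) • unitVec θ hθ (schreier β α) i)
          (U x : Space θ hθ (schreier β α))) ∧
    -- `U` extends to a surjective linear isometry of the whole space
    ∃ V : Space θ hθ (schreier β α) ≃ₗᵢ[ℝ] Space θ hθ (schreier β α),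
      ∀ x : Metric.sphere (0 : Space θ hθ (schreier β α)) 1,
        V x = (U x : Space θ hθ (schreier β α)) := by
  have hθ0 := hθ.1
  have hN0 : 0 < N := by
    have : (0 : ℝ) < N := hN ▸ inv_pos.2 hθ0
    exact_mod_cast this
  obtain ⟨n, rfl⟩ : ∃ n : ℕ+, N = n := ⟨⟨N, hN0⟩, rfl⟩
  have hn : θ * ((n : ℕ) : ℝ) = 1 := by rw [← hN, mul_inv_cancel₀ hθ0.ne']
  have hF := regular_schreier hβ α hα
  have hS : ∀ G : Finset ℕ+, (∀ k ∈ G, G.card ≤ (k : ℕ)) → G ∈ schreier β α := fun G hG =>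
    schreier_one_subset hβ α hα1 hα ((mem_schreier_one β G).2 hG)
  let W : Sphere θ hθ (schreier β α) ≃ᵢ Sphere θ hθ (schreier β α) :=
    ⟨Equiv.ofBijective U ⟨hU.injective, hU'⟩, hU⟩
  obtain ⟨ε, π, hε, hcoord⟩ := exists_perm_coord_map hF hS hn W
  obtain ⟨V, hVU, hV⟩ := exists_linearIsometryEquiv W hcoord
  have hπ : ∀ A : Finset ℕ+, (n : ℕ) < A.card →
      (A.image π ∈ schreier β α ↔ A ∈ schreier β α) := fun A hA =>
    mem_iff_of_perm hF hn hε V hV hA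
  have hε' : ∀ i, ε i = 1 ∨ ε i = -1 := fun i => (abs_eq zero_le_one).1 (hε i)
  have hVe : ∀ i, V (unitVec θ hθ (schreier β α) i) =
      ε i • unitVec θ hθ (schreier β α) (π i) := by
    intro i
    refine ext_coord fun k => ?_
    obtain ⟨j, rfl⟩ := π.surjective k
    rw [hV, coord_smul, coord_unitVec, coord_unitVec]
    by_cases hij : j = i
    · simp [hij]
    · simp [hij]
  have hsum : ∀ (x : Metric.sphere (0 : Space θ hθ (schreier β α)) 1) (a : ℕ+ → ℝ),
      HasSum (fun i => a i • unitVec θ hθ (schreier β α) i) (x : Space θ hθ (schreier β α)) →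
      HasSum (fun i => (ε i * a i) • unitVec θ hθ (schreier β α) (π i))
        (U x : Space θ hθ (schreier β α)) := by
    intro x a hx
    have h1 : HasSum (fun i => V (a i • unitVec θ hθ (schreier β α) i))
        (V (x : Space θ hθ (schreier β α))) :=
      hx.mapL (V.toContinuousLinearEquiv : Space θ hθ (schreier β α) →L[ℝ]
        Space θ hθ (schreier β α))
    have h2 : V (x : Space θ hθ (schreier β α)) = (U x : Space θ hθ (schreier β α)) := hVU x
    rw [← h2]
    simpa only [map_smul, hVe, smul_smul, mul_comm] using h1
  refine ⟨existsUnique_hasSum, ?_, fun h1 => ⟨ε, hε', ?_⟩, V, hVU⟩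
  · rintro rfl
    exact ⟨ε, π, hε', fun i hi => perm_eq_of_preserves_schreier_one hπ hi, hsum⟩
  · have hid : ∀ i, π i = i := perm_eq_of_preserves_schreier hβ h1 hα hπ
    simpa only [hid] using hsum
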